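/- Let $X$ be a compact Hausdorff space. A $C(X)$-algebra is a $C^*$-algebra $A$ (not necessarily unital) together with a unital $*$-homomorphism $\Phi_A$ from $C(X)$ into the center of the multiplier algebra of $A$; write $f\cdot a=\Phi_A(f)a$. Tensor products $\otimes$ of $C^*$-algebras are maximal, $\mathcal K$ denotes the compact operators on $\ell^2$, $SA = A\otimes C_0(\mathbb R)$, and $A[0,1]=C([0,1],A)$; if $A$ is a $C(X)$-algebra, then so are $A\otimes\mathcal K$, $SA$ and $A[0,1]$, with $C(X)$ acting on $A$. A $C(X)$-morphism is a $C(X)$-linear $*$-homomorphism. An asymptotic $C(X)$-morphism $\{\psi_t\}_{t\in[1,\infty)}:A\to B$ is a family of maps $\psi_t:A\to B$ such that $t\mapsto\psi_t(a)$ is bounded and continuous for every $a\in A$ and such that, as $t\to\infty$, the elements $$\psi_t(a+b)-\psi_t(a)-\psi_t(b),\quad \psi_t(\lambda a)-\lambda\psi_t(a),\quad \psi_t(ab)-\psi_t(a)\psi_t(b),\quad \psi_t(a^*)-\psi_t(a)^*,\quad \psi_t(f\cdot a)-f\cdot\psi_t(a)$$ tend to $0$ for all $a,b\in A$, $\lambda\in\mathbb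 C$, $f\in C(X)$. Two of them, $\psi^0$ and $\psi^1$, are homotopic if there is an asymptotic $C(X)$-morphism $\Psi:A\to B[0,1]$ whose evaluations at $0$ and $1$ are $\psi^0$ and $\psi^1$; $[\![A,B]\!]_X$ is the set of homotopy classes. The suspension of $\psi$ is the asymptotic $C(X)$-morphism $S\psi:SA\to SB$, unique up to asymptotic equivalence, with $S\psi_t(a\otimes g)-\psi_t(a)\otimes g\to0$. Put $$\mathcal{R}E(X;A,B)=\varinjlim_{n\in\mathbb N}\,[\![S^n(A\otimes\mathcal K),S^n(B\otimes\mathcal K)]\!]_X ,$$ the limit being taken over suspension. A $C(X)$-morphism $\varphi:A\to B$ has a class $[\![\varphi]\!]_X\in\mathcal{R}E(X;A,B)$, that of the constant family $\varphi\otimes\mathrm{id}_{\mathcal K}$ (with $n=0$). If $A$ is unital, then $f\mapsto f\cdot 1_A$ is a $C(X)$-morphism $\Phi_A:C(X)\to A$, and the fundamental class of $A$ is $[\![A]\!]_X=[\![\Phi_A]\!]_X\in\mathcal{R}E(X;C(X),A)$. Let $p:Y\to X$ be a continuous map of compact Hausdorff spaces. For a $C(X)$-algebra $A$ let $p^*A=C(Y)\otimes_X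 A$, the quotient of $C(Y)\otimes A$ by the closed ideal generated by the elements $(f\circ p)g\otimes a-g\otimes f\cdot a$ with $f\in C(X)$, $g\in C(Y)$, $a\in A$; it is a $C(Y)$-algebra through its left factor. There are canonical isomorphisms $p^*C(X)\cong C(Y)$ and $p^*(S^n(A\otimes\mathcal K))\cong S^n(p^*A\otimes\mathcal K)$ of $C(Y)$-algebras. The pullback transformation $p^*:\mathcal{R}E(X;A,B)\to\mathcal{R}E(Y;p^*A,p^*B)$ sends the class of $\psi:S^n(A\otimes\mathcal K)\to S^n(B\otimes\mathcal K)$ to the class of $\mathrm{id}_{C(Y)}\otimes_X\psi$, that is, of the asymptotic $C(Y)$-morphism $\theta$, unique up to asymptotic equivalence, with $\theta_t(g\otimes_X x)-g\otimes_X\psi_t(x)\to0$ for $g\in C(Y)$ and $x\in S^n(A\otimes\mathcal K)$. **Proposition.** Let $p:Y\to X$ be a continuous map of compact Hausdorff spaces and let $A$ be a unital $C(X)$-algebra. Then $p^*A$ is unital and, under the pullback transformation $$p^*:\mathcal{R}E(X;C(X),A)\to\mathcal{R}E(Y;p^*C(X),p^*A)\cong\mathcal{R}E(Y;C(Y),p^*A),$$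 we have $p^*[\![A]\!]_X=[\![p^*A]\!]_Y$. -/

import Mathlib

open scoped TensorProduct Topology BoundedContinuousFunction Pointwise
open Filter

universe u

noncomputable section

set_option linter.unusedSectionVars false

/-! ### Largest C⋆-seminorms and C⋆-completions -/

/-- A C⋆-seminorm on a complex ⋆-algebra `D`. -/
structure CStarSeminorm (D : Type*) [NonUnitalRing D] [StarRing D] [Module ℂ D] extends
    Seminorm ℂ D where
  mul_le' : ∀ x y, toFun (x * y) ≤ toFun x * toFun y
  star_mul_self' : ∀ x, toFun (star x * x) = toFun x ^ 2

namespace CStarSeminorm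

section Basic

variable {D : Type*} [NonUnitalRing D] [StarRing D] [Module ℂ D]

instance : CoeFun (CStarSeminorm D) (fun _ => D → ℝ) := ⟨fun N => N.toSeminorm⟩

variable (N : CStarSeminorm D)

lemma nonneg (x : D) : 0 ≤ N x := apply_nonneg N.toSeminorm x
lemma mul_le (x y : D) : N (x * y) ≤ N x * N y := N.mul_le' x y
lemma star_mul_self (x : D) : N (star x * x) = N x ^ 2 := N.star_mul_self' x
lemma add_le (x y : D) : N (x + y) ≤ N x + N y := map_add_le_add N.toSeminorm x y
lemma zero : N 0 = 0 := map_zero N.toSeminorm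
lemma smul (c : ℂ) (x : D) : N (c • x) = ‖c‖ * N x := map_smul_eq_mul N.toSeminorm c x

lemma le_star (x : D) : N x ≤ N (star x) := by
  rcases (N.nonneg x).eq_or_lt with h | h
  · rw [← h]; exact N.nonneg _
  · have h1 := N.mul_le (star x) x
    rw [N.star_mul_self, sq] at h1
    exact le_of_mul_le_mul_right h1 h

lemma star_eq (x : D) : N (star x) = N x :=
  le_antisymm (by simpa using N.le_star (star x)) (N.le_star x)

/-- The largest of a family of C⋆-seminorms that is bounded at every element and nonempty. -/
def sup (S : Set (CStarSeminorm D)) (hne : S.Nonempty)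
    (hb : ∀ x, BddAbove ((fun N : CStarSeminorm D => N x) '' S)) : CStarSeminorm D where
  toFun x := sSup ((fun N : CStarSeminorm D => N x) '' S)
  map_zero' := by
    have : (fun N : CStarSeminorm D => N 0) '' S = {0} := by
      obtain ⟨N, hN⟩ := hne
      ext r; constructor
      · rintro ⟨M, -, rfl⟩; exact M.zero
      · rintro rfl; exact ⟨N, hN, N.zero⟩
    rw [this, csSup_singleton]
  add_le' x y := by
    refine csSup_le (hne.image _) ?_
    rintro _ ⟨N, hN, rfl⟩
    exact (N.add_le x y).trans
      (add_le_add (le_csSup (hb x) ⟨N, hN, rfl⟩) (le_csSup (hb y) ⟨N, hN, rfl⟩))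
  neg' x := by
    congr 1
    refine Set.image_congr fun N _ => ?_
    exact map_neg_eq_map N.toSeminorm x
  smul' c x := by
    have : (fun N : CStarSeminorm D => N (c • x)) '' S =
        ‖c‖ • ((fun N : CStarSeminorm D => N x) '' S) := by
      ext r; constructor
      · rintro ⟨N, hN, rfl⟩; exact ⟨N x, ⟨N, hN, rfl⟩, (N.smul c x).symm⟩
      · rintro ⟨_, ⟨N, hN, rfl⟩, rfl⟩; exact ⟨N, hN, N.smul c x⟩
    rw [this, Real.sSup_smul_of_nonneg (norm_nonneg c), smul_eq_mul]
  mul_le' x y := by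
    refine csSup_le (hne.image _) ?_
    rintro _ ⟨N, hN, rfl⟩
    exact (N.mul_le x y).trans
      (mul_le_mul (le_csSup (hb x) ⟨N, hN, rfl⟩) (le_csSup (hb y) ⟨N, hN, rfl⟩) (N.nonneg y)
        ((N.nonneg x).trans (le_csSup (hb x) ⟨N, hN, rfl⟩)))
  star_mul_self' x := by
    have h0 : 0 ≤ sSup ((fun N : CStarSeminorm D => N x) '' S) := by
      obtain ⟨N, hN⟩ := hne
      exact (N.nonneg x).trans (le_csSup (hb x) ⟨N, hN, rfl⟩)
    apply le_antisymm
    · refine csSup_le (hne.image _) ?_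
      rintro _ ⟨N, hN, rfl⟩
      change N (star x * x) ≤ _
      rw [N.star_mul_self]
      exact pow_le_pow_left₀ (N.nonneg x) (le_csSup (hb x) ⟨N, hN, rfl⟩) 2
    · rw [← Real.le_sqrt h0 (by
        obtain ⟨N, hN⟩ := hne
        exact (N.nonneg _).trans (le_csSup (hb (star x * x)) ⟨N, hN, rfl⟩))]
      refine csSup_le (hne.image _) ?_
      rintro _ ⟨N, hN, rfl⟩
      refine Real.le_sqrt_of_sq_le ?_
      change N x ^ 2 ≤ _
      rw [← N.star_mul_self]
      exact le_csSup (hb (star x * x)) ⟨N, hN, rfl⟩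

lemma le_sup {S : Set (CStarSeminorm D)} {hne : S.Nonempty}
    {hb : ∀ x, BddAbove ((fun N : CStarSeminorm D => N x) '' S)} {N : CStarSeminorm D}
    (hN : N ∈ S) (x : D) : N x ≤ sup S hne hb x :=
  le_csSup (hb x) ⟨N, hN, rfl⟩

lemma sup_le {S : Set (CStarSeminorm D)} {hne : S.Nonempty}
    {hb : ∀ x, BddAbove ((fun N : CStarSeminorm D => N x) '' S)} {x : D} {r : ℝ}
    (h : ∀ N ∈ S, N x ≤ r) : sup S hne hb x ≤ r := by
  refine csSup_le (hne.image _) ?_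
  rintro _ ⟨N, hN, rfl⟩
  exact h N hN

/-- The C⋆-seminorm induced by a ⋆-homomorphism into a C⋆-algebra. -/
def ofHom {F : Type*} [NonUnitalCStarAlgebra F] (φ : D →⋆ₙₐ[ℂ] F) : CStarSeminorm D where
  toFun x := ‖φ x‖
  map_zero' := by simp
  add_le' x y := by rw [map_add]; exact norm_add_le _ _
  neg' x := by rw [← norm_neg (φ x)]; congr 1; exact map_neg φ x
  smul' c x := by rw [map_smul, norm_smul]
  mul_le' x y := by rw [map_mul]; exact norm_mul_le _ _
  star_mul_self' x := by rw [map_mul, map_star, CStarRing.norm_star_mul_self, sq]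

end Basic

section Completion

variable {D : Type*} [NonUnitalRing D] [StarRing D] [Module ℂ D] [StarModule ℂ D]
  [IsScalarTower ℂ D D] [SMulCommClass ℂ D D]

/-- The algebra `D`, to be normed by a C⋆-seminorm `N`. -/
def Pre (_N : CStarSeminorm D) : Type _ := D

variable (N : CStarSeminorm D)

instance : NonUnitalRing N.Pre := inferInstanceAs (NonUnitalRing D)
instance : StarRing N.Pre := inferInstanceAs (StarRing D)
instance : Module ℂ N.Pre := inferInstanceAs (Module ℂ D)
instance : StarModule ℂ N.Pre := inferInstanceAs (StarModule ℂ D)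
instance : IsScalarTower ℂ N.Pre N.Pre := inferInstanceAs (IsScalarTower ℂ D D)
instance : SMulCommClass ℂ N.Pre N.Pre := inferInstanceAs (SMulCommClass ℂ D D)

instance : SeminormedAddCommGroup N.Pre :=
  AddGroupSeminorm.toSeminormedAddCommGroup (E := N.Pre)
    { toFun := fun x => N x
      map_zero' := N.zero
      add_le' := N.add_le
      neg' := fun x => map_neg_eq_map N.toSeminorm x }

instance : NonUnitalSeminormedRing N.Pre where
  __ := (inferInstance : SeminormedAddCommGroup N.Pre)
  __ := (inferInstance : NonUnitalRing N.Pre)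
  norm_mul_le := N.mul_le

instance : NormedSpace ℂ N.Pre where
  norm_smul_le c x := (N.smul c x).le

instance : NormedStarGroup N.Pre where
  norm_star_le x := (N.star_eq x).le

/-- The Hausdorff completion of `D` with respect to a C⋆-seminorm, a C⋆-algebra. -/
def Completion : Type _ := UniformSpace.Completion N.Pre

namespace Completion

instance : NormedAddCommGroup N.Completion :=
  inferInstanceAs (NormedAddCommGroup (UniformSpace.Completion N.Pre))
instance : NormedSpace ℂ N.Completion :=
  inferInstanceAs (NormedSpace ℂ (UniformSpace.Completion N.Pre))
instance : CompleteSpace N.Completion :=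
  inferInstanceAs (CompleteSpace (UniformSpace.Completion N.Pre))

/-- The canonical additive map into the completion. -/
def mkAdd : N.Pre →+ N.Completion := UniformSpace.Completion.toCompl

lemma isDenseInducing_mkAdd : IsDenseInducing (mkAdd N) :=
  UniformSpace.Completion.isDenseInducing_coe

lemma norm_mkAdd (x : N.Pre) : ‖mkAdd N x‖ = ‖x‖ := UniformSpace.Completion.norm_coe x

lemma mkAdd_smul (c : ℂ) (x : N.Pre) : mkAdd N (c • x) = c • mkAdd N x :=
  UniformSpace.Completion.coe_smul c x

variable {N} in
@[elab_as_elim]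
lemma ind {P : N.Completion → Prop} (x : N.Completion) (hc : IsClosed {x | P x})
    (h : ∀ d, P (mkAdd N d)) : P x :=
  isClosed_property (isDenseInducing_mkAdd N).dense hc h x

/-- The multiplication, extended by continuity. -/
instance : Mul N.Completion :=
  ⟨fun x y => ((isDenseInducing_mkAdd N).prodMap (isDenseInducing_mkAdd N)).extend
    (fun p : N.Pre × N.Pre => mkAdd N (p.1 * p.2)) (x, y)⟩

lemma continuous_mkAdd : Continuous (mkAdd N) := (isDenseInducing_mkAdd N).continuous

lemma mkAdd_mul (x y : N.Pre) : mkAdd N (x * y) = mkAdd N x * mkAdd N y :=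
  (((isDenseInducing_mkAdd N).prodMap (isDenseInducing_mkAdd N)).extend_eq
    (f := fun p : N.Pre × N.Pre => mkAdd N (p.1 * p.2))
    ((continuous_mkAdd N).comp continuous_mul) (x, y)).symm

instance : ContinuousMul N.Completion where
  continuous_mul := by
    let m := (AddMonoidHom.mul : N.Pre →+ N.Pre →+ N.Pre).compr₂ (mkAdd N)
    have : Continuous fun p : N.Pre × N.Pre => m p.1 p.2 :=
      (continuous_mkAdd N).comp continuous_mul
    exact ((isDenseInducing_mkAdd N).extend_Z_bilin (isDenseInducing_mkAdd N) this :)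

/-- The involution, extended by continuity. -/
instance : Star N.Completion :=
  ⟨(isDenseInducing_mkAdd N).extend (fun d => mkAdd N (star d))⟩

lemma mkAdd_star (x : N.Pre) : mkAdd N (star x) = star (mkAdd N x) :=
  ((isDenseInducing_mkAdd N).extend_eq (f := fun d => mkAdd N (star d))
    ((continuous_mkAdd N).comp continuous_star) x).symm

instance : ContinuousStar N.Completion where
  continuous_star := by
    have h : UniformContinuous (fun d : N.Pre => (mkAdd N (star d))) := by
      refine AddMonoidHomClass.uniformContinuous_of_bound
        ((mkAdd N).comp (starAddEquiv : N.Pre ≃+ N.Pre).toAddMonoidHom) 1 fun x => ?_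
      simp [norm_mkAdd]
    exact (uniformContinuous_uniformly_extend
      (UniformSpace.Completion.isUniformInducing_coe N.Pre) (isDenseInducing_mkAdd N).dense
        h).continuous

variable {N}

@[elab_as_elim]
lemma ind₂ {P : N.Completion → N.Completion → Prop} (x y : N.Completion)
    (hc : IsClosed {p : N.Completion × N.Completion | P p.1 p.2})
    (h : ∀ d e, P (mkAdd N d) (mkAdd N e)) : P x y :=
  isClosed_property2 (isDenseInducing_mkAdd N).dense hc h x y

@[elab_as_elim]
lemma ind₃ {P : N.Completion → N.Completion → N.Completion → Prop} (x y z : N.Completion)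
    (hc : IsClosed {p : N.Completion × N.Completion × N.Completion | P p.1 p.2.1 p.2.2})
    (h : ∀ d e f, P (mkAdd N d) (mkAdd N e) (mkAdd N f)) : P x y z :=
  isClosed_property3 (isDenseInducing_mkAdd N).dense hc h x y z

lemma mul_add_aux (x y z : N.Completion) : x * (y + z) = x * y + x * z :=
  ind₃ x y z (isClosed_eq (by fun_prop) (by fun_prop)) fun x y z => by
    rw [← map_add, ← mkAdd_mul, mul_add, map_add, mkAdd_mul, mkAdd_mul]

lemma add_mul_aux (x y z : N.Completion) : (x + y) * z = x * z + y * z :=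
  ind₃ x y z (isClosed_eq (by fun_prop) (by fun_prop)) fun x y z => by
    rw [← map_add, ← mkAdd_mul, add_mul, map_add, mkAdd_mul, mkAdd_mul]

lemma zero_mul_aux (x : N.Completion) : 0 * x = 0 :=
  ind x (isClosed_eq (by fun_prop) (by fun_prop)) fun x => by
    rw [← map_zero (mkAdd N), ← mkAdd_mul, zero_mul]

lemma mul_zero_aux (x : N.Completion) : x * 0 = 0 :=
  ind x (isClosed_eq (by fun_prop) (by fun_prop)) fun x => by
    rw [← map_zero (mkAdd N), ← mkAdd_mul, mul_zero]

lemma mul_assoc_aux (x y z : N.Completion) : x * y * z = x * (y * z) :=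
  ind₃ x y z (isClosed_eq (by fun_prop) (by fun_prop)) fun x y z => by
    rw [← mkAdd_mul, ← mkAdd_mul, ← mkAdd_mul, ← mkAdd_mul, mul_assoc]

lemma norm_mul_aux (x y : N.Completion) : ‖x * y‖ ≤ ‖x‖ * ‖y‖ :=
  ind₂ x y (isClosed_le (by fun_prop) (by fun_prop)) fun x y => by
    rw [← mkAdd_mul, norm_mkAdd, norm_mkAdd, norm_mkAdd]; exact N.mul_le x y

lemma star_star_aux (x : N.Completion) : star (star x) = x :=
  ind x (isClosed_eq (by fun_prop) (by fun_prop)) fun x => by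
    rw [← mkAdd_star, ← mkAdd_star, star_star]

lemma star_mul_aux (x y : N.Completion) : star (x * y) = star y * star x :=
  ind₂ x y (isClosed_eq (by fun_prop) (by fun_prop)) fun x y => by
    rw [← mkAdd_star, ← mkAdd_star, ← mkAdd_mul, ← mkAdd_mul, ← mkAdd_star, star_mul]

lemma star_add_aux (x y : N.Completion) : star (x + y) = star x + star y :=
  ind₂ x y (isClosed_eq (by fun_prop) (by fun_prop)) fun x y => by
    rw [← mkAdd_star, ← mkAdd_star, ← map_add, ← map_add, ← mkAdd_star, star_add]

lemma continuous_smul_aux (c : ℂ) : Continuous (fun x : N.Completion => c • x) :=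
  continuous_const_smul c

lemma star_smul_aux (c : ℂ) (x : N.Completion) : star (c • x) = star c • star x :=
  ind x (isClosed_eq (continuous_star.comp (continuous_smul_aux c))
    ((continuous_smul_aux (star c)).comp continuous_star)) fun x => by
    rw [← mkAdd_star, ← mkAdd_smul, ← mkAdd_smul, ← mkAdd_star, star_smul]

lemma norm_mul_self_aux (x : N.Completion) : ‖x‖ * ‖x‖ ≤ ‖star x * x‖ :=
  ind x (isClosed_le (by fun_prop) (by fun_prop)) fun x => by
    rw [← mkAdd_star, ← mkAdd_mul, norm_mkAdd, norm_mkAdd, ← sq]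
    exact (N.star_mul_self x).ge

lemma smul_mul_aux (c : ℂ) (x y : N.Completion) : c • x * y = c • (x * y) :=
  ind₂ x y (isClosed_eq
    (((continuous_smul_aux c).comp continuous_fst).mul continuous_snd)
    ((continuous_smul_aux c).comp continuous_mul)) fun x y => by
    rw [← mkAdd_smul, ← mkAdd_mul, ← mkAdd_mul, ← mkAdd_smul, smul_mul_assoc]

lemma mul_smul_aux (c : ℂ) (x y : N.Completion) : x * c • y = c • (x * y) :=
  ind₂ x y (isClosed_eq
    (continuous_fst.mul ((continuous_smul_aux c).comp continuous_snd))
    ((continuous_smul_aux c).comp continuous_mul)) fun x y => by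
    rw [← mkAdd_smul, ← mkAdd_mul, ← mkAdd_mul, ← mkAdd_smul, mul_smul_comm]

variable (N)

instance : NonUnitalRing N.Completion :=
  { (inferInstance : AddCommGroup N.Completion), (inferInstance : Mul N.Completion) with
    left_distrib := mul_add_aux
    right_distrib := add_mul_aux
    zero_mul := zero_mul_aux
    mul_zero := mul_zero_aux
    mul_assoc := mul_assoc_aux }

instance : NonUnitalNormedRing N.Completion :=
  { (inferInstance : NormedAddCommGroup N.Completion),
    (inferInstance : NonUnitalRing N.Completion) with
    norm_mul_le := norm_mul_aux }

instance : NonUnitalCStarAlgebra N.Completion :=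
  { (inferInstance : NonUnitalNormedRing N.Completion),
    (inferInstance : NormedSpace ℂ N.Completion),
    (inferInstance : CompleteSpace N.Completion),
    (inferInstance : Star N.Completion) with
    star_involutive := star_star_aux
    star_mul := star_mul_aux
    star_add := star_add_aux
    norm_mul_self_le := norm_mul_self_aux
    smul_assoc := smul_mul_aux
    smul_comm := fun c x y => (mul_smul_aux c x y).symm
    star_smul := star_smul_aux }

end Completion

/-- The canonical ⋆-homomorphism of `D` into its completion. -/
def toCompl : D →⋆ₙₐ[ℂ] N.Completion where
  toFun := Completion.mkAdd N
  map_smul' := Completion.mkAdd_smul N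
  map_zero' := map_zero (Completion.mkAdd N)
  map_add' := map_add (Completion.mkAdd N)
  map_mul' := Completion.mkAdd_mul N
  map_star' := Completion.mkAdd_star N

lemma norm_toCompl (x : D) : ‖N.toCompl x‖ = N x := Completion.norm_mkAdd N x

lemma denseRange_toCompl : DenseRange N.toCompl := (Completion.isDenseInducing_mkAdd N).dense

/-- The continuous linear extension to the completion of a bounded linear map. -/
def liftCLM {F : Type*} [NormedAddCommGroup F] [NormedSpace ℂ F] [CompleteSpace F]
    (φ : D →ₗ[ℂ] F) (C : ℝ) (h : ∀ x, ‖φ x‖ ≤ C * N x) : N.Completion →L[ℂ] F :=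
  (LinearMap.mkContinuous (E := N.Pre) φ C h).extend
    (UniformSpace.Completion.toComplₗᵢ : N.Pre →ₗᵢ[ℂ] _).toContinuousLinearMap

lemma liftCLM_toCompl {F : Type*} [NormedAddCommGroup F] [NormedSpace ℂ F] [CompleteSpace F]
    (φ : D →ₗ[ℂ] F) (C : ℝ) (h : ∀ x, ‖φ x‖ ≤ C * N x) (x : D) :
    N.liftCLM φ C h (N.toCompl x) = φ x :=
  ContinuousLinearMap.extend_eq _ (e :=
    (UniformSpace.Completion.toComplₗᵢ : N.Pre →ₗᵢ[ℂ] _).toContinuousLinearMap)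
    (N.denseRange_toCompl) (UniformSpace.Completion.isUniformInducing_coe N.Pre) x

variable {N} in
@[elab_as_elim]
lemma ind {P : N.Completion → Prop} (x : N.Completion) (hc : IsClosed {x | P x})
    (h : ∀ d, P (N.toCompl d)) : P x :=
  isClosed_property N.denseRange_toCompl hc h x

/-- The extension to the completion of a bounded ⋆-homomorphism. -/
def lift {F : Type*} [NonUnitalCStarAlgebra F] (φ : D →⋆ₙₐ[ℂ] F) (h : ∀ x, ‖φ x‖ ≤ N x) :
    N.Completion →⋆ₙₐ[ℂ] F :=
  let L : N.Completion →L[ℂ] F := N.liftCLM (φ : D →ₗ[ℂ] F) 1 (by simpa using h)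
  have hL : ∀ x, L (N.toCompl x) = φ x := N.liftCLM_toCompl _ _ _
  { toFun := L
    map_smul' := map_smul L
    map_zero' := map_zero L
    map_add' := map_add L
    map_mul' := fun x y => by
      induction x using ind with
      | hc => exact isClosed_eq (by fun_prop) (by fun_prop)
      | h x => ?_
      induction y using ind with
      | hc => exact isClosed_eq (by fun_prop) (by fun_prop)
      | h y => rw [← map_mul, hL, hL, hL, map_mul]
    map_star' := fun x => by
      induction x using ind with
      | hc => exact isClosed_eq (by fun_prop) (by fun_prop)
      | h x => rw [← map_star]; erw [hL, hL]; rw [map_star] }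

lemma lift_toCompl {F : Type*} [NonUnitalCStarAlgebra F] (φ : D →⋆ₙₐ[ℂ] F) (h : ∀ x, ‖φ x‖ ≤ N x)
    (x : D) : N.lift φ h (N.toCompl x) = φ x :=
  N.liftCLM_toCompl _ _ _ x

end Completion

end CStarSeminorm

/-! ### Maximal tensor products -/

section MaxTensor

variable {A C : Type*} [NonUnitalCStarAlgebra A] [NonUnitalCStarAlgebra C]

/-- The C⋆-seminorms on the algebraic tensor product `A ⊙ C` that vanish on the set `rel`. The
bound on elementary tensors holds automatically for C⋆-seminorms and is recorded for
convenience. -/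
def crossSeminorms (rel : Set (A ⊗[ℂ] C)) : Set (CStarSeminorm (A ⊗[ℂ] C)) :=
  {N | (∀ a c, N (a ⊗ₜ c) ≤ ‖a‖ * ‖c‖) ∧ ∀ x ∈ rel, N x = 0}

lemma crossSeminorms_nonempty (rel : Set (A ⊗[ℂ] C)) : (crossSeminorms rel).Nonempty :=
  ⟨{ toSeminorm := 0
     mul_le' := fun x y => by change (0 : ℝ) ≤ 0 * 0; simp
     star_mul_self' := fun x => by change (0 : ℝ) = 0 ^ 2; simp },
    fun a c => by change (0 : ℝ) ≤ _; positivity, fun _ _ => rfl⟩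

lemma crossSeminorms_bddAbove (rel : Set (A ⊗[ℂ] C)) (x : A ⊗[ℂ] C) :
    BddAbove ((fun N : CStarSeminorm (A ⊗[ℂ] C) => N x) '' crossSeminorms rel) := by
  induction x using TensorProduct.induction_on with
  | zero => exact ⟨0, by rintro _ ⟨N, -, rfl⟩; exact N.zero.le⟩
  | tmul a c => exact ⟨‖a‖ * ‖c‖, by rintro _ ⟨N, hN, rfl⟩; exact hN.1 a c⟩
  | add x y hx hy =>
    obtain ⟨r, hr⟩ := hx
    obtain ⟨s, hs⟩ := hy
    refine ⟨r + s, ?_⟩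
    rintro _ ⟨N, hN, rfl⟩
    exact (N.add_le x y).trans (add_le_add (hr ⟨N, hN, rfl⟩) (hs ⟨N, hN, rfl⟩))

/-- The largest C⋆-seminorm on `A ⊙ C` that vanishes on `rel`. -/
def maxSeminorm (rel : Set (A ⊗[ℂ] C)) : CStarSeminorm (A ⊗[ℂ] C) :=
  CStarSeminorm.sup (crossSeminorms rel) (crossSeminorms_nonempty rel)
    (crossSeminorms_bddAbove rel)

lemma maxSeminorm_tmul_le (rel : Set (A ⊗[ℂ] C)) (a : A) (c : C) :
    maxSeminorm rel (a ⊗ₜ c) ≤ ‖a‖ * ‖c‖ :=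
  CStarSeminorm.sup_le fun _ hN => hN.1 a c

lemma maxSeminorm_rel {rel : Set (A ⊗[ℂ] C)} {x : A ⊗[ℂ] C} (hx : x ∈ rel) :
    maxSeminorm rel x = 0 :=
  le_antisymm (CStarSeminorm.sup_le fun _ hN => (hN.2 x hx).le) (CStarSeminorm.nonneg _ _)

/-- The Hausdorff completion of `A ⊙ C` in the largest C⋆-seminorm that vanishes on `rel`.
Equivalently, the quotient of the maximal C⋆-tensor product `A ⊗ C` by the closed ideal that
`rel` generates. For `rel = ∅` this is the maximal C⋆-tensor product. -/
abbrev MaxTensor (rel : Set (A ⊗[ℂ] C)) : Type _ := (maxSeminorm rel).Completion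

namespace MaxTensor

variable (rel : Set (A ⊗[ℂ] C))

/-- The image of the elementary tensor `a ⊗ c`. -/
def tmul (a : A) (c : C) : MaxTensor rel := (maxSeminorm rel).toCompl (a ⊗ₜ c)

lemma norm_tmul_le (a : A) (c : C) : ‖tmul rel a c‖ ≤ ‖a‖ * ‖c‖ := by
  rw [tmul, CStarSeminorm.norm_toCompl]; exact maxSeminorm_tmul_le rel a c

lemma tmul_mul (a b : A) (c d : C) : tmul rel a c * tmul rel b d = tmul rel (a * b) (c * d) := by
  rw [tmul, tmul, ← map_mul, Algebra.TensorProduct.tmul_mul_tmul]; rfl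

lemma star_tmul (a : A) (c : C) : star (tmul rel a c) = tmul rel (star a) (star c) := by
  rw [tmul, ← map_star, TensorProduct.star_tmul]; rfl

lemma add_tmul (a b : A) (c : C) : tmul rel (a + b) c = tmul rel a c + tmul rel b c := by
  rw [tmul, TensorProduct.add_tmul, map_add]; rfl

lemma tmul_add (a : A) (c d : C) : tmul rel a (c + d) = tmul rel a c + tmul rel a d := by
  rw [tmul, TensorProduct.tmul_add, map_add]; rfl

lemma smul_tmul (z : ℂ) (a : A) (c : C) : tmul rel (z • a) c = z • tmul rel a c := by
  rw [tmul, ← TensorProduct.smul_tmul', map_smul]; rfl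

lemma tmul_smul (z : ℂ) (a : A) (c : C) : tmul rel a (z • c) = z • tmul rel a c := by
  rw [tmul, TensorProduct.tmul_smul, map_smul]; rfl

lemma zero_tmul (c : C) : tmul rel (0 : A) c = 0 := by
  rw [tmul, TensorProduct.zero_tmul, map_zero]

/-- The span of the elementary tensors is dense. -/
@[elab_as_elim]
lemma ind {P : MaxTensor rel → Prop} (x : MaxTensor rel) (hc : IsClosed {x | P x})
    (h0 : P 0) (hadd : ∀ x y, P x → P y → P (x + y)) (ht : ∀ a c, P (tmul rel a c)) : P x := by
  induction x using CStarSeminorm.ind with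
  | hc => exact hc
  | h d =>
    induction d using TensorProduct.induction_on with
    | zero => rwa [map_zero]
    | tmul a c => exact ht a c
    | add x y hx hy => rw [map_add]; exact hadd _ _ hx hy

/-- The ⋆-homomorphism `A ⊙ C → F` given by a multiplicative bilinear map. -/
def algLift {F : Type*} [NonUnitalCStarAlgebra F] (β : A →ₗ[ℂ] C →ₗ[ℂ] F)
    (hm : ∀ a b c d, β (a * b) (c * d) = β a c * β b d)
    (hs : ∀ a c, β (star a) (star c) = star (β a c)) : A ⊗[ℂ] C →⋆ₙₐ[ℂ] F where
  toFun := TensorProduct.lift β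
  map_smul' := map_smul _
  map_zero' := map_zero _
  map_add' := map_add _
  map_mul' x y := by
    induction x using TensorProduct.induction_on with
    | zero => simp
    | add x₁ x₂ h₁ h₂ => rw [add_mul, map_add, h₁, h₂, map_add, add_mul]
    | tmul a c =>
      induction y using TensorProduct.induction_on with
      | zero => simp
      | add x₁ x₂ h₁ h₂ => rw [mul_add, map_add, h₁, h₂, map_add, mul_add]
      | tmul b d => simp [hm]
  map_star' x := by
    induction x using TensorProduct.induction_on with
    | zero => simp
    | add x₁ x₂ h₁ h₂ =>
      rw [star_add]
      erw [map_add, map_add]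
      rw [star_add]; exact congrArg₂ _ h₁ h₂
    | tmul a c => simp [hs]

/-- The universal property of the (relative) maximal tensor product. -/
def lift {F : Type*} [NonUnitalCStarAlgebra F] (β : A →ₗ[ℂ] C →ₗ[ℂ] F)
    (hm : ∀ a b c d, β (a * b) (c * d) = β a c * β b d)
    (hs : ∀ a c, β (star a) (star c) = star (β a c))
    (hb : ∀ a c, ‖β a c‖ ≤ ‖a‖ * ‖c‖)
    (hr : ∀ x ∈ rel, TensorProduct.lift β x = 0) : MaxTensor rel →⋆ₙₐ[ℂ] F :=
  (maxSeminorm rel).lift (algLift β hm hs) fun x =>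
    have h : CStarSeminorm.ofHom (algLift β hm hs) ∈ crossSeminorms rel :=
      ⟨fun a c => (hb a c), fun x hx => by
        change ‖TensorProduct.lift β x‖ = 0
        rw [hr x hx, norm_zero]⟩
    CStarSeminorm.le_sup h x

lemma lift_tmul {F : Type*} [NonUnitalCStarAlgebra F] (β : A →ₗ[ℂ] C →ₗ[ℂ] F)
    (hm : ∀ a b c d, β (a * b) (c * d) = β a c * β b d)
    (hs : ∀ a c, β (star a) (star c) = star (β a c))
    (hb : ∀ a c, ‖β a c‖ ≤ ‖a‖ * ‖c‖)
    (hr : ∀ x ∈ rel, TensorProduct.lift β x = 0) (a : A) (c : C) :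
    lift rel β hm hs hb hr (tmul rel a c) = β a c :=
  ((maxSeminorm rel).lift_toCompl _ _ _).trans (TensorProduct.lift.tmul a c)

lemma norm_hom_le {A B : Type*} [NonUnitalCStarAlgebra A] [NonUnitalCStarAlgebra B]
    (φ : A →⋆ₙₐ[ℂ] B) (a : A) : ‖φ a‖ ≤ ‖a‖ := NonUnitalStarAlgHom.norm_apply_le φ a

/-- The bilinear map `(a, c) ↦ φ a ⊗ c`. -/
def mapAux {B : Type*} [NonUnitalCStarAlgebra B] (φ : A →⋆ₙₐ[ℂ] B) :
    A →ₗ[ℂ] C →ₗ[ℂ] MaxTensor (∅ : Set (B ⊗[ℂ] C)) :=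
  LinearMap.mk₂ ℂ (fun a c => tmul ∅ (φ a) c)
    (fun a b c => by rw [map_add, add_tmul]) (fun z a c => by rw [map_smul, smul_tmul])
    (fun a c d => tmul_add _ _ _ _) (fun z a c => tmul_smul _ _ _ _)

/-- The ⋆-homomorphism `φ ⊗ id : A ⊗ C → B ⊗ C` of maximal tensor products. -/
def map {B : Type*} [NonUnitalCStarAlgebra B] (C : Type*) [NonUnitalCStarAlgebra C]
    (φ : A →⋆ₙₐ[ℂ] B) :
    MaxTensor (∅ : Set (A ⊗[ℂ] C)) →⋆ₙₐ[ℂ] MaxTensor (∅ : Set (B ⊗[ℂ] C)) :=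
  lift ∅ (mapAux φ)
    (fun a b c d => by simp [mapAux, tmul_mul])
    (fun a c => by simp [mapAux, star_tmul, map_star φ])
    (fun a c => (norm_tmul_le _ _ _).trans
      (mul_le_mul_of_nonneg_right (norm_hom_le φ a) (norm_nonneg c)))
    (fun x hx => hx.elim)

lemma map_tmul {B : Type*} [NonUnitalCStarAlgebra B] (C : Type*) [NonUnitalCStarAlgebra C]
    (φ : A →⋆ₙₐ[ℂ] B) (a : A) (c : C) : map C φ (tmul ∅ a c) = tmul ∅ (φ a) c :=
  lift_tmul _ _ _ _ _ _ _ _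

end MaxTensor

end MaxTensor

/-! ### C(X)-algebras over a compact space -/

/-- A unital `C(X)`-module structure on a complex ⋆-algebra `D` by central multipliers that is
compatible with the involution. For a C⋆-algebra `D` it is the same as a unital
⋆-homomorphism from `C(X)` to the center of the multiplier algebra of `D`. -/
class CXAction (X : Type*) [TopologicalSpace X] (D : Type*) [NonUnitalRing D] [StarRing D]
    [Module ℂ D] extends Module C(X, ℂ) D where
  smul_assoc' (z : ℂ) (f : C(X, ℂ)) (d : D) : (z • f) • d = z • (f • d)
  smul_mul' (f : C(X, ℂ)) (d e : D) : (f • d) * e = f • (d * e)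
  mul_smul' (f : C(X, ℂ)) (d e : D) : d * (f • e) = f • (d * e)
  star_smul' (f : C(X, ℂ)) (d : D) : star (f • d) = star f • star d

/-- A norm estimate in C⋆-algebras: if `x⋆x + y⋆y = r² z⋆z` then `‖x‖ ≤ r ‖z‖`. -/
lemma CStar.norm_le_of_star_mul_add {E : Type*} [NonUnitalCStarAlgebra E] {x y z : E} {r : ℝ}
    (hr : 0 ≤ r) (h : star x * x + star y * y = ((r ^ 2 : ℝ) : ℂ) • (star z * z)) :
    ‖x‖ ≤ r * ‖z‖ := by
  let _ := CStarAlgebra.spectralOrder E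
  have := CStarAlgebra.spectralOrderedRing E
  have h1 : ‖star x * x‖ ≤ ‖star x * x + star y * y‖ :=
    CStarAlgebra.norm_le_norm_of_nonneg_of_le (star_mul_self_nonneg x)
      (le_add_of_nonneg_right (star_mul_self_nonneg y))
  rw [h, norm_smul, CStarRing.norm_star_mul_self, CStarRing.norm_star_mul_self] at h1
  refine abs_le_of_sq_le_sq' ?_ (by positivity) |>.2
  have : ‖((r ^ 2 : ℝ) : ℂ)‖ = r ^ 2 := by
    rw [Complex.norm_real, Real.norm_of_nonneg (by positivity)]
  rw [this] at h1
  nlinarith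

section Action

variable {X : Type*} [TopologicalSpace X] [CompactSpace X]

section

variable {D : Type*} [NonUnitalRing D] [StarRing D] [Module ℂ D] [CXAction X D]

lemma CXAction.smul_comm_complex (f : C(X, ℂ)) (z : ℂ) (d : D) : f • (z • d) = z • (f • d) := by
  have h : z • d = (z • (1 : C(X, ℂ))) • d := by rw [CXAction.smul_assoc', one_smul]
  rw [h, smul_smul, mul_comm, ← smul_smul, CXAction.smul_assoc', one_smul]

/-- The function `(‖f‖² - |f|²)^{1/2}`. -/
def coNorm (f : C(X, ℂ)) : C(X, ℂ) :=
  ⟨fun x => ((Real.sqrt (‖f‖ ^ 2 - ‖f x‖ ^ 2) : ℝ) : ℂ), by fun_prop⟩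

lemma coNorm_spec (f : C(X, ℂ)) :
    star f * f + star (coNorm f) * coNorm f = ((‖f‖ ^ 2 : ℝ) : ℂ) • (1 : C(X, ℂ)) := by
  ext x
  have h1 : ‖f x‖ ^ 2 ≤ ‖f‖ ^ 2 := pow_le_pow_left₀ (norm_nonneg _) (f.norm_coe_le_norm x) 2
  have h2 : star (f x) * f x = ((‖f x‖ ^ 2 : ℝ) : ℂ) := by
    rw [mul_comm]; simpa using Complex.mul_conj' (f x)
  simp only [ContinuousMap.add_apply, ContinuousMap.mul_apply, ContinuousMap.star_apply, h2,
    ContinuousMap.smul_apply, ContinuousMap.one_apply, smul_eq_mul, mul_one]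
  simp only [coNorm, ContinuousMap.coe_mk, Complex.star_def, Complex.conj_ofReal]
  rw [← Complex.ofReal_mul, Real.mul_self_sqrt (by linarith), ← Complex.ofReal_add]
  congr 1; ring

lemma CStarSeminorm.norm_smul_le [StarModule ℂ D] [IsScalarTower ℂ D D] [SMulCommClass ℂ D D]
    (N : CStarSeminorm D) (f : C(X, ℂ)) (d : D) : N (f • d) ≤ ‖f‖ * N d := by
  have key : star (f • d) * (f • d) + star (coNorm f • d) * (coNorm f • d) =
      ((‖f‖ ^ 2 : ℝ) : ℂ) • (star d * d) := by
    simp only [CXAction.star_smul', CXAction.smul_mul', CXAction.mul_smul', smul_smul]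
    rw [← add_smul, mul_comm f, mul_comm (coNorm f), coNorm_spec, CXAction.smul_assoc', one_smul]
  have := congrArg N.toCompl key
  simp only [map_add, map_mul, map_star, map_smul] at this
  have := CStar.norm_le_of_star_mul_add (norm_nonneg f) this
  rwa [N.norm_toCompl, N.norm_toCompl] at this

end

lemma CXAction.norm_smul_le {E : Type*} [NonUnitalCStarAlgebra E] [CXAction X E]
    (f : C(X, ℂ)) (a : E) : ‖f • a‖ ≤ ‖f‖ * ‖a‖ :=
  (CStarSeminorm.ofHom (NonUnitalStarAlgHom.id ℂ E)).norm_smul_le f a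

instance CXAction.isBoundedSMul {E : Type*} [NonUnitalCStarAlgebra E] [CXAction X E] :
    IsBoundedSMul C(X, ℂ) E :=
  IsBoundedSMul.of_norm_smul_le CXAction.norm_smul_le

/-- The action on a C⋆-completion, extended by continuity. -/
instance CStarSeminorm.completionAction {D : Type*} [NonUnitalRing D] [StarRing D] [Module ℂ D]
    [CXAction X D] [StarModule ℂ D] [IsScalarTower ℂ D D] [SMulCommClass ℂ D D]
    (N : CStarSeminorm D) : CXAction X N.Completion :=
  let L (f : C(X, ℂ)) : N.Completion →L[ℂ] N.Completion :=
    N.liftCLM { toFun := fun d => N.toCompl (f • d)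
                map_add' := fun d e => by rw [smul_add, map_add]
                map_smul' := fun z d => by
                  rw [CXAction.smul_comm_complex, map_smul, RingHom.id_apply] } ‖f‖
      fun d => by
        change ‖N.toCompl (f • d)‖ ≤ _
        rw [N.norm_toCompl]; exact N.norm_smul_le f d
  have hL (f : C(X, ℂ)) (d : D) : L f (N.toCompl d) = N.toCompl (f • d) :=
    N.liftCLM_toCompl _ _ _ d
  { smul := fun f x => L f x
    one_smul := fun x => by
      change L 1 x = x
      induction x using ind with
      | hc => exact isClosed_eq (L _).continuous continuous_id
      | h x => rw [hL, one_smul]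
    mul_smul := fun f g x => by
      change L (f * g) x = L f (L g x)
      induction x using ind with
      | hc => exact isClosed_eq (L _).continuous ((L _).continuous.comp (L _).continuous)
      | h x => rw [hL, hL, hL, mul_smul]
    smul_zero := fun f => map_zero (L f)
    smul_add := fun f => map_add (L f)
    add_smul := fun f g x => by
      change L (f + g) x = L f x + L g x
      induction x using ind with
      | hc => exact isClosed_eq (L _).continuous ((L _).continuous.add (L _).continuous)
      | h x => rw [hL, hL, hL, add_smul, map_add]
    zero_smul := fun x => by
      change L 0 x = 0
      induction x using ind with
      | hc => exact isClosed_eq (L _).continuous continuous_const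
      | h x => rw [hL, zero_smul, map_zero]
    smul_assoc' := fun z f x => by
      change L (z • f) x = z • L f x
      induction x using ind with
      | hc => exact isClosed_eq (L _).continuous ((L _).continuous.const_smul z)
      | h x => rw [hL, hL, CXAction.smul_assoc', map_smul]
    smul_mul' := fun f x y => by
      change L f x * y = L f (x * y)
      induction x using ind with
      | hc => exact isClosed_eq ((L _).continuous.mul continuous_const)
                ((L _).continuous.comp (continuous_id.mul continuous_const))
      | h x => ?_
      induction y using ind with
      | hc => exact isClosed_eq (continuous_const.mul continuous_id)
                ((L _).continuous.comp (continuous_const.mul continuous_id))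
      | h y => rw [← map_mul, hL, hL, ← map_mul, CXAction.smul_mul']
    mul_smul' := fun f x y => by
      change x * L f y = L f (x * y)
      induction x using ind with
      | hc => exact isClosed_eq (continuous_id.mul continuous_const)
                ((L _).continuous.comp (continuous_id.mul continuous_const))
      | h x => ?_
      induction y using ind with
      | hc => exact isClosed_eq (continuous_const.mul (L _).continuous)
                ((L _).continuous.comp (continuous_const.mul continuous_id))
      | h y => rw [← map_mul, hL, hL, ← map_mul, CXAction.mul_smul']
    star_smul' := fun f x => by
      change star (L f x) = L (star f) (star x)
      induction x using ind with
      | hc => exact isClosed_eq (continuous_star.comp (L _).continuous)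
                ((L _).continuous.comp continuous_star)
      | h x => rw [hL, ← map_star, ← map_star, hL, CXAction.star_smul'] }

lemma CStarSeminorm.smul_toCompl {D : Type*} [NonUnitalRing D] [StarRing D] [Module ℂ D]
    [CXAction X D] [StarModule ℂ D] [IsScalarTower ℂ D D] [SMulCommClass ℂ D D]
    (N : CStarSeminorm D) (f : C(X, ℂ)) (d : D) :
    f • N.toCompl d = N.toCompl (f • d) :=
  N.liftCLM_toCompl _ _ _ d

/-- The action of `C(X)` on `A ⊙ C` through the left factor. -/
instance CXAction.tensor {A C : Type*} [NonUnitalCStarAlgebra A] [NonUnitalCStarAlgebra C]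
    [CXAction X A] : CXAction X (A ⊗[ℂ] C) :=
  let L (f : C(X, ℂ)) : A →ₗ[ℂ] A :=
    { toFun := fun a => f • a
      map_add' := smul_add f
      map_smul' := fun z a => CXAction.smul_comm_complex f z a }
  { smul := fun f => (L f).rTensor C
    one_smul := fun x => by
      change (L 1).rTensor C x = x
      have : L 1 = LinearMap.id := by ext; exact one_smul _ _
      rw [this, LinearMap.rTensor_id]; rfl
    mul_smul := fun f g x => by
      change (L (f * g)).rTensor C x = (L f).rTensor C ((L g).rTensor C x)
      have : L (f * g) = L f ∘ₗ L g := by ext; exact mul_smul _ _ _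
      rw [this, LinearMap.rTensor_comp]; rfl
    smul_zero := fun f => map_zero _
    smul_add := fun f => map_add _
    add_smul := fun f g x => by
      change (L (f + g)).rTensor C x = (L f).rTensor C x + (L g).rTensor C x
      have : L (f + g) = L f + L g := by ext; exact add_smul _ _ _
      rw [this, LinearMap.rTensor_add]; rfl
    zero_smul := fun x => by
      change (L 0).rTensor C x = 0
      have : L 0 = 0 := by ext; exact zero_smul _ _
      rw [this, LinearMap.rTensor_zero]; rfl
    smul_assoc' := fun z f x => by
      change (L (z • f)).rTensor C x = z • (L f).rTensor C x
      have : L (z • f) = z • L f := by ext; exact CXAction.smul_assoc' _ _ _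
      rw [this, LinearMap.rTensor_smul]; rfl
    smul_mul' := fun f x y => by
      change (L f).rTensor C x * y = (L f).rTensor C (x * y)
      induction x using TensorProduct.induction_on with
      | zero => simp
      | add x₁ x₂ h₁ h₂ => rw [map_add, add_mul, add_mul, map_add, h₁, h₂]
      | tmul a c =>
        induction y using TensorProduct.induction_on with
        | zero => simp
        | add x₁ x₂ h₁ h₂ => rw [mul_add, mul_add, map_add, h₁, h₂]
        | tmul b d =>
          simp only [LinearMap.rTensor_tmul, Algebra.TensorProduct.tmul_mul_tmul]
          exact congrArg (· ⊗ₜ[ℂ] (c * d)) (CXAction.smul_mul' f a b)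
    mul_smul' := fun f x y => by
      change x * (L f).rTensor C y = (L f).rTensor C (x * y)
      induction x using TensorProduct.induction_on with
      | zero => simp
      | add x₁ x₂ h₁ h₂ => rw [add_mul, add_mul, map_add, h₁, h₂]
      | tmul a c =>
        induction y using TensorProduct.induction_on with
        | zero => simp
        | add x₁ x₂ h₁ h₂ => rw [map_add, mul_add, mul_add, map_add, h₁, h₂]
        | tmul b d =>
          simp only [LinearMap.rTensor_tmul, Algebra.TensorProduct.tmul_mul_tmul]
          exact congrArg (· ⊗ₜ[ℂ] (c * d)) (CXAction.mul_smul' f a b)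
    star_smul' := fun f x => by
      change star ((L f).rTensor C x) = (L (star f)).rTensor C (star x)
      induction x using TensorProduct.induction_on with
      | zero => simp
      | add x₁ x₂ h₁ h₂ => rw [map_add, star_add, star_add, map_add, h₁, h₂]
      | tmul a c =>
        simp only [LinearMap.rTensor_tmul, TensorProduct.star_tmul]
        exact congrArg (· ⊗ₜ[ℂ] star c) (CXAction.star_smul' f a) }

lemma CXAction.smul_tmul {A C : Type*} [NonUnitalCStarAlgebra A] [NonUnitalCStarAlgebra C]
    [CXAction X A] (f : C(X, ℂ)) (a : A) (c : C) : f • (a ⊗ₜ[ℂ] c) = (f • a) ⊗ₜ[ℂ] c := rfl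

lemma MaxTensor.action_tmul {A C : Type*} [NonUnitalCStarAlgebra A] [NonUnitalCStarAlgebra C]
    [CXAction X A] (rel : Set (A ⊗[ℂ] C)) (f : C(X, ℂ)) (a : A) (c : C) :
    f • MaxTensor.tmul rel a c = MaxTensor.tmul rel (f • a) c :=
  (maxSeminorm rel).smul_toCompl f _

end Action

/-- The Hilbert space `ℓ²`. -/
abbrev HilbertSeq : Type := lp (fun _ : ℕ => ℂ) 2

lemma IsCompactOperator.adjoint_of_hilbert {H : Type*} [NormedAddCommGroup H]
    [InnerProductSpace ℂ H] [CompleteSpace H] {T : H →L[ℂ] H} (hT : IsCompactOperator T) :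
    IsCompactOperator (star T : H →L[ℂ] H) := by
  have hS : IsCompactOperator (T * star T : H →L[ℂ] H) := hT.comp_clm (star T)
  refine (isCompactOperator_iff_isCompact_closure_image_closedBall
    ((star T : H →L[ℂ] H) : H →ₛₗ[RingHom.id ℂ] H) one_pos).2 ?_
  have h1 : TotallyBounded ((T * star T : H →L[ℂ] H) '' Metric.closedBall (0 : H) 1) :=
    ((isCompactOperator_iff_isCompact_closure_image_closedBall
      ((T * star T : H →L[ℂ] H) : H →ₛₗ[RingHom.id ℂ] H) one_pos).1
      hS).totallyBounded.subset subset_closure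
  refine (TotallyBounded.closure ?_).isCompact_of_isClosed isClosed_closure
  rw [Metric.totallyBounded_iff]
  intro ε hε
  obtain ⟨t, hts, htf, hcov⟩ :=
    Metric.finite_approx_of_totallyBounded h1 (ε ^ 2 / 4) (by positivity)
  have hts' : ∀ y : H, ∃ c : H, y ∈ t →
      c ∈ Metric.closedBall (0 : H) 1 ∧ (T * star T : H →L[ℂ] H) c = y := fun y => by
    by_cases hy : y ∈ t
    · obtain ⟨c, hc⟩ := hts hy
      exact ⟨c, fun _ => hc⟩
    · exact ⟨0, fun h => (hy h).elim⟩
  choose c hc using hts'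
  refine ⟨(fun y => (star T : H →L[ℂ] H) (c y)) '' t, htf.image _, ?_⟩
  rintro _ ⟨x, hx, rfl⟩
  have h2 := hcov ⟨x, hx, rfl⟩
  simp only [Set.mem_iUnion, Metric.mem_ball, exists_prop] at h2
  obtain ⟨y, hy, hxy⟩ := h2
  simp only [Set.mem_iUnion, Metric.mem_ball, exists_prop, Set.exists_mem_image]
  refine ⟨y, hy, ?_⟩
  obtain ⟨hc1, hc2⟩ := hc y hy
  rw [← hc2, dist_eq_norm, ← map_sub] at hxy
  rw [dist_eq_norm]
  change ‖(star T : H →L[ℂ] H) x - (star T : H →L[ℂ] H) (c y)‖ < ε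
  rw [← map_sub]
  have h3 : ‖x - c y‖ ≤ 2 := by
    have := norm_sub_le x (c y)
    have h4 : ‖x‖ ≤ 1 := by simpa using hx
    have h5 : ‖c y‖ ≤ 1 := by simpa using hc1
    linarith
  have h4 : ‖(star T : H →L[ℂ] H) (x - c y)‖ ^ 2 ≤
      ‖(T * star T : H →L[ℂ] H) (x - c y)‖ * ‖x - c y‖ := by
    rw [← inner_self_eq_norm_sq (𝕜 := ℂ)]
    refine (RCLike.re_le_norm _).trans ?_
    have h5 : inner ℂ ((star T : H →L[ℂ] H) (x - c y)) ((star T : H →L[ℂ] H) (x - c y)) =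
        inner ℂ ((T * star T : H →L[ℂ] H) (x - c y)) (x - c y) :=
      ContinuousLinearMap.adjoint_inner_right T _ _
    rw [h5]
    exact norm_inner_le_norm _ _
  have h5 := mul_le_mul_of_nonneg_left h3 (norm_nonneg ((T * star T : H →L[ℂ] H) (x - c y)))
  exact lt_of_pow_lt_pow_left₀ 2 hε.le (by nlinarith)

/-- The C⋆-algebra of compact operators on `ℓ²`. -/
def compactOperators : NonUnitalStarSubalgebra ℂ (HilbertSeq →L[ℂ] HilbertSeq) where
  carrier := {T | IsCompactOperator T}
  add_mem' := fun h₁ h₂ => h₁.add h₂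
  zero_mem' := isCompactOperator_zero
  mul_mem' := fun {_ T} h₁ _ => IsCompactOperator.comp_clm h₁ T
  smul_mem' := fun c _ h => h.smul c
  star_mem' := fun h => h.adjoint_of_hilbert

instance isClosed_compactOperators :
    IsClosed (compactOperators : Set (HilbertSeq →L[ℂ] HilbertSeq)) :=
  isClosed_setOfPred_isCompactOperator

/-- The action of `C(X)` on itself. -/
instance CXAction.self (X : Type*) [TopologicalSpace X] [CompactSpace X] :
    CXAction X C(X, ℂ) where
  smul_assoc' := fun z f d => smul_assoc z f d
  smul_mul' := fun f d e => smul_mul_assoc f d e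
  mul_smul' := fun f d e => mul_smul_comm f d e
  star_smul' := fun f d => by simp

/-- The pointwise action on continuous functions with values in a `C(X)`-algebra. -/
instance CXAction.continuousMap (X : Type*) [TopologicalSpace X] [CompactSpace X]
    (A : Type*) [NonUnitalCStarAlgebra A] [CXAction X A] :
    CXAction X C(unitInterval, A) where
  smul := fun f b => ⟨fun s => f • b s, b.continuous.const_smul f⟩
  one_smul := fun b => by ext s; exact one_smul _ _
  mul_smul := fun f g b => by ext s; exact mul_smul _ _ _
  smul_zero := fun f => by ext s; exact smul_zero _
  smul_add := fun f b c => by ext s; exact smul_add _ _ _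
  add_smul := fun f g b => by ext s; exact add_smul _ _ _
  zero_smul := fun b => by ext s; exact zero_smul _ _
  smul_assoc' := fun z f d => by ext s; exact CXAction.smul_assoc' _ _ _
  smul_mul' := fun f d e => by ext s; exact CXAction.smul_mul' _ _ _
  mul_smul' := fun f d e => by ext s; exact CXAction.mul_smul' _ _ _
  star_smul' := fun f d => by ext s; exact CXAction.star_smul' _ _

/-- A `C(X)`-algebra over a compact space `X`: a C⋆-algebra, in general without unit, with a
unital action of `C(X)` by central multipliers. -/
structure CXAlgebra (X : Type u) [TopologicalSpace X] [CompactSpace X] where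
  /-- The underlying type. -/
  carrier : Type u
  [cstar : NonUnitalCStarAlgebra carrier]
  [action : CXAction X carrier]

namespace CXAlgebra

variable {X Y : Type u} [TopologicalSpace X] [CompactSpace X] [TopologicalSpace Y]
  [CompactSpace Y]

instance : CoeSort (CXAlgebra X) (Type u) := ⟨carrier⟩

instance (A : CXAlgebra X) : NonUnitalCStarAlgebra A := A.cstar
instance (A : CXAlgebra X) : CXAction X A := A.action

/-- `C(X)` as a `C(X)`-algebra. -/
def base (X : Type u) [TopologicalSpace X] [CompactSpace X] : CXAlgebra X := ⟨C(X, ℂ)⟩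

/-- The maximal tensor product `A ⊗ C` with `f • (a ⊗ c) = (f • a) ⊗ c`. -/
def tensor (A : CXAlgebra X) (C : Type) [NonUnitalCStarAlgebra C] : CXAlgebra X :=
  ⟨MaxTensor (∅ : Set (A ⊗[ℂ] C))⟩

/-- The elementary tensor `a ⊗ c`. -/
def tmul {A : CXAlgebra X} {C : Type} [NonUnitalCStarAlgebra C] (a : A) (c : C) : A.tensor C :=
  MaxTensor.tmul ∅ a c

/-- The stabilization `A ⊗ 𝓚`. -/
abbrev stab (A : CXAlgebra X) : CXAlgebra X := A.tensor compactOperators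

/-- The suspension `S A = A ⊗ C₀(ℝ)`, that is, `C₀(ℝ, A)`. -/
abbrev susp (A : CXAlgebra X) : CXAlgebra X := A.tensor (ZeroAtInftyContinuousMap ℝ ℂ)

/-- The iterated suspension `Sⁿ A`. -/
def iterSusp : ℕ → CXAlgebra X → CXAlgebra X
  | 0, A => A
  | n + 1, A => (iterSusp n A).susp

/-- The algebra `A[0,1] = C([0,1], A)`. -/
def interval (A : CXAlgebra X) : CXAlgebra X := ⟨C(unitInterval, A)⟩

/-- The relations `(f ∘ p) g ⊗ a = g ⊗ f • a` of the balanced tensor product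
`C(Y) ⊗_X A`. -/
def pullbackRel (p : C(Y, X)) (A : CXAlgebra X) : Set (C(Y, ℂ) ⊗[ℂ] A) :=
  {x | ∃ (f : C(X, ℂ)) (g : C(Y, ℂ)) (a : A),
    x = (f.comp p * g) ⊗ₜ[ℂ] a - g ⊗ₜ[ℂ] (f • a)}

/-- The pullback `p^* A = C(Y) ⊗_X A`, a `C(Y)`-algebra through its left factor. -/
def pullback (p : C(Y, X)) (A : CXAlgebra X) : CXAlgebra Y := ⟨MaxTensor (pullbackRel p A)⟩

/-- The image of `g ⊗ a` in `p^* A`. -/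
def pullbackMk (p : C(Y, X)) {A : CXAlgebra X} (g : C(Y, ℂ)) (a : A) : A.pullback p :=
  MaxTensor.tmul (pullbackRel p A) g a

/-- `A` has a multiplicative unit. -/
def IsUnital (A : CXAlgebra X) : Prop := ∃ e : A, ∀ a : A, e * a = a ∧ a * e = a

end CXAlgebra

namespace CXAlgebra

variable {X Y : Type u} [TopologicalSpace X] [CompactSpace X] [TopologicalSpace Y]
  [CompactSpace Y]

/-! ### Morphisms -/

/-- A ⋆-homomorphism `φ` from a `C(X)`-algebra to a `C(Y)`-algebra that is linear over
`p : Y → X`: `φ (f • a) = (f ∘ p) • φ a`. -/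
structure HomOver (p : C(Y, X)) (A : CXAlgebra X) (B : CXAlgebra Y) where
  /-- The underlying ⋆-homomorphism. -/
  hom : A →⋆ₙₐ[ℂ] B
  map_action : ∀ (f : C(X, ℂ)) (a : A), hom (f • a) = f.comp p • hom a

/-- A `C(X)`-morphism, that is, a `C(X)`-linear ⋆-homomorphism. -/
abbrev Hom (A B : CXAlgebra X) : Type u := HomOver (ContinuousMap.id X) A B

lemma Hom.map_action' {A B : CXAlgebra X} (φ : Hom A B) (f : C(X, ℂ)) (a : A) :
    φ.hom (f • a) = f • φ.hom a := φ.map_action f a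

lemma action_tmul {A : CXAlgebra X} {C : Type} [NonUnitalCStarAlgebra C] (f : C(X, ℂ)) (a : A)
    (c : C) : f • tmul a c = tmul (f • a) c := MaxTensor.action_tmul ∅ f a c

lemma action_pullbackMk (p : C(Y, X)) {A : CXAlgebra X} (h g : C(Y, ℂ)) (a : A) :
    h • pullbackMk p g a = pullbackMk p (h * g) a :=
  MaxTensor.action_tmul (pullbackRel p A) h g a

@[elab_as_elim]
lemma tensor_ind {A : CXAlgebra X} {C : Type} [NonUnitalCStarAlgebra C] {P : A.tensor C → Prop}
    (x : A.tensor C) (hc : IsClosed {x | P x}) (h0 : P 0)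
    (hadd : ∀ x y, P x → P y → P (x + y)) (ht : ∀ a c, P (tmul a c)) : P x :=
  MaxTensor.ind ∅ x hc h0 hadd ht

@[elab_as_elim]
lemma pullback_ind {p : C(Y, X)} {A : CXAlgebra X} {P : A.pullback p → Prop}
    (x : A.pullback p) (hc : IsClosed {x | P x}) (h0 : P 0)
    (hadd : ∀ x y, P x → P y → P (x + y)) (ht : ∀ g a, P (pullbackMk p g a)) : P x :=
  MaxTensor.ind (pullbackRel p A) x hc h0 hadd ht

lemma continuous_hom {A : CXAlgebra X} {B : CXAlgebra Y} (φ : A →⋆ₙₐ[ℂ] B) : Continuous φ :=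
  AddMonoidHomClass.continuous_of_bound φ 1 fun a => by
    simpa using NonUnitalStarAlgHom.norm_apply_le φ a

lemma continuous_action {A : CXAlgebra X} (f : C(X, ℂ)) : Continuous fun a : A => f • a :=
  continuous_const_smul f

/-- The ⋆-homomorphism `φ ⊗ id : A ⊗ C → B ⊗ C`. -/
def tensorMap {A : CXAlgebra X} {B : CXAlgebra Y} (φ : A →⋆ₙₐ[ℂ] B) (C : Type)
    [NonUnitalCStarAlgebra C] : A.tensor C →⋆ₙₐ[ℂ] B.tensor C := MaxTensor.map C φ

lemma tensorMap_tmul {A : CXAlgebra X} {B : CXAlgebra Y} (φ : A →⋆ₙₐ[ℂ] B) {C : Type}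
    [NonUnitalCStarAlgebra C] (a : A) (c : C) : tensorMap φ C (tmul a c) = tmul (φ a) c :=
  MaxTensor.map_tmul C φ a c

/-- The morphism `φ ⊗ id : A ⊗ C → B ⊗ C`. -/
def HomOver.tensor {p : C(Y, X)} {A : CXAlgebra X} {B : CXAlgebra Y} (φ : HomOver p A B)
    (C : Type) [NonUnitalCStarAlgebra C] : HomOver p (A.tensor C) (B.tensor C) where
  hom := tensorMap φ.hom C
  map_action f x := by
    induction x using tensor_ind with
    | hc =>
      exact isClosed_eq ((continuous_hom _).comp (continuous_action f))
        ((continuous_action _).comp (continuous_hom _))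
    | h0 => rw [smul_zero, map_zero, smul_zero]
    | hadd x y hx hy => rw [smul_add, map_add, map_add, smul_add, hx, hy]
    | ht a c => rw [action_tmul, tensorMap_tmul, tensorMap_tmul, φ.map_action, action_tmul]

lemma HomOver.tensor_tmul {p : C(Y, X)} {A : CXAlgebra X} {B : CXAlgebra Y} (φ : HomOver p A B)
    {C : Type} [NonUnitalCStarAlgebra C] (a : A) (c : C) :
    (φ.tensor C).hom (tmul a c) = tmul (φ.hom a) c := tensorMap_tmul φ.hom a c

/-- `φ ⊗ id : A ⊗ 𝓚 → B ⊗ 𝓚`. -/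
def HomOver.stab {p : C(Y, X)} {A : CXAlgebra X} {B : CXAlgebra Y} (φ : HomOver p A B) :
    HomOver p A.stab B.stab := φ.tensor compactOperators

/-- `Sⁿ φ : Sⁿ A → Sⁿ B`. -/
def HomOver.iterSusp {p : C(Y, X)} {A : CXAlgebra X} {B : CXAlgebra Y} (φ : HomOver p A B) :
    (n : ℕ) → HomOver p (A.iterSusp n) (B.iterSusp n)
  | 0 => φ
  | n + 1 => (φ.iterSusp n).tensor (ZeroAtInftyContinuousMap ℝ ℂ)

section Mk

variable (p : C(Y, X)) {A : CXAlgebra X}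

lemma pullbackMk_mul (g h : C(Y, ℂ)) (a b : A) :
    pullbackMk p g a * pullbackMk p h b = pullbackMk p (g * h) (a * b) :=
  MaxTensor.tmul_mul _ _ _ _ _

lemma star_pullbackMk (g : C(Y, ℂ)) (a : A) :
    star (pullbackMk p g a) = pullbackMk p (star g) (star a) := MaxTensor.star_tmul _ _ _

lemma pullbackMk_add_left (g h : C(Y, ℂ)) (a : A) :
    pullbackMk p (g + h) a = pullbackMk p g a + pullbackMk p h a := MaxTensor.add_tmul _ _ _ _

lemma pullbackMk_add_right (g : C(Y, ℂ)) (a b : A) :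
    pullbackMk p g (a + b) = pullbackMk p g a + pullbackMk p g b := MaxTensor.tmul_add _ _ _ _

lemma pullbackMk_smul_left (z : ℂ) (g : C(Y, ℂ)) (a : A) :
    pullbackMk p (z • g) a = z • pullbackMk p g a := MaxTensor.smul_tmul _ _ _ _

lemma pullbackMk_smul_right (z : ℂ) (g : C(Y, ℂ)) (a : A) :
    pullbackMk p g (z • a) = z • pullbackMk p g a := MaxTensor.tmul_smul _ _ _ _

lemma pullbackMk_balanced (f : C(X, ℂ)) (g : C(Y, ℂ)) (a : A) :
    pullbackMk p (f.comp p * g) a = pullbackMk p g (f • a) := by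
  rw [← sub_eq_zero]
  have h := maxSeminorm_rel (rel := pullbackRel p A) ⟨f, g, a, rfl⟩
  rw [← CStarSeminorm.norm_toCompl, map_sub, norm_eq_zero] at h
  exact h

end Mk

/-- The canonical ⋆-homomorphism `A → p^* A`, `a ↦ 1 ⊗ a`. -/
def pullbackUnit (p : C(Y, X)) (A : CXAlgebra X) : HomOver p A (A.pullback p) where
  hom :=
    { toFun := fun a => pullbackMk p 1 a
      map_smul' := fun z a => pullbackMk_smul_right p z 1 a
      map_zero' := by simpa using pullbackMk_smul_right p 0 1 (0 : A)
      map_add' := fun a b => pullbackMk_add_right p 1 a b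
      map_mul' := fun a b => by rw [pullbackMk_mul, one_mul]
      map_star' := fun a => by rw [star_pullbackMk, star_one] }
  map_action f a := by
    change pullbackMk p 1 (f • a) = f.comp p • pullbackMk p 1 a
    rw [action_pullbackMk, pullbackMk_balanced]

lemma pullbackUnit_apply (p : C(Y, X)) {A : CXAlgebra X} (a : A) :
    (pullbackUnit p A).hom a = pullbackMk p 1 a := rfl

/-- The constant function `1`. -/
def baseOne (X : Type u) [TopologicalSpace X] [CompactSpace X] : base X := (1 : C(X, ℂ))

lemma baseOne_mul : baseOne X * baseOne X = baseOne X := one_mul (1 : C(X, ℂ))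

lemma star_baseOne : star (baseOne X) = baseOne X := star_one C(X, ℂ)

/-- The ⋆-homomorphism `C(Y) → p^* C(X)`, `g ↦ g ⊗ 1`. -/
def pullbackBaseHom (p : C(Y, X)) : C(Y, ℂ) →⋆ₙₐ[ℂ] (base X).pullback p where
  toFun g := pullbackMk p g (baseOne X)
  map_smul' z g := pullbackMk_smul_left p z g (baseOne X)
  map_zero' := MaxTensor.zero_tmul _ _
  map_add' g h := pullbackMk_add_left p g h (baseOne X)
  map_mul' g h := by rw [pullbackMk_mul, baseOne_mul]
  map_star' g := by rw [star_pullbackMk, star_baseOne]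

/-- The canonical isomorphism `C(Y) → p^* C(X)`, `g ↦ g ⊗ 1`, as a `C(Y)`-morphism. -/
def pullbackBase (p : C(Y, X)) : Hom (base Y) ((base X).pullback p) where
  hom := pullbackBaseHom p
  map_action f g := (action_pullbackMk p f g (baseOne X)).symm

/-- The unit of a unital `C(X)`-algebra. -/
def IsUnital.unit {A : CXAlgebra X} (hA : A.IsUnital) : A := hA.choose

lemma IsUnital.unit_mul {A : CXAlgebra X} (hA : A.IsUnital) (a : A) : hA.unit * a = a :=
  (hA.choose_spec a).1

lemma IsUnital.mul_unit {A : CXAlgebra X} (hA : A.IsUnital) (a : A) : a * hA.unit = a :=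
  (hA.choose_spec a).2

lemma IsUnital.eq_unit {A : CXAlgebra X} (hA : A.IsUnital) {e : A} (he : ∀ a, e * a = a) :
    e = hA.unit := by rw [← hA.mul_unit e, he]

lemma IsUnital.star_unit {A : CXAlgebra X} (hA : A.IsUnital) : star hA.unit = hA.unit :=
  hA.eq_unit fun a => by
    rw [← star_star a, ← star_mul, hA.mul_unit]

lemma IsUnital.pullback {A : CXAlgebra X} (hA : A.IsUnital) (p : C(Y, X)) :
    (A.pullback p).IsUnital := by
  refine ⟨pullbackMk p 1 hA.unit, fun x => ?_⟩
  induction x using pullback_ind with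
  | hc =>
    exact (isClosed_eq (continuous_const.mul continuous_id) continuous_id).inter
      (isClosed_eq (continuous_id.mul continuous_const) continuous_id)
  | h0 => exact ⟨mul_zero _, zero_mul _⟩
  | hadd x y hx hy => rw [mul_add, add_mul, hx.1, hx.2, hy.1, hy.2]; exact ⟨rfl, rfl⟩
  | ht g a =>
    constructor
    · rw [pullbackMk_mul, one_mul, hA.unit_mul]
    · rw [pullbackMk_mul, mul_one, hA.mul_unit]

/-- The ⋆-homomorphism `C(X) → A`, `f ↦ f • 1`, of a unital `C(X)`-algebra. -/
def structuralHom (A : CXAlgebra X) (hA : A.IsUnital) : C(X, ℂ) →⋆ₙₐ[ℂ] A where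
  toFun f := f • hA.unit
  map_smul' z f := CXAction.smul_assoc' z f hA.unit
  map_zero' := zero_smul C(X, ℂ) hA.unit
  map_add' f g := add_smul f g hA.unit
  map_mul' f g := by rw [CXAction.smul_mul', hA.unit_mul, smul_smul]
  map_star' f := by rw [CXAction.star_smul', hA.star_unit]

/-- The structural `C(X)`-morphism `Φ_A : C(X) → A` of a unital `C(X)`-algebra. -/
def structural (A : CXAlgebra X) (hA : A.IsUnital) : Hom (base X) A where
  hom := structuralHom A hA
  map_action f g := mul_smul f (show C(X, ℂ) from g) hA.unit

/-- The evaluation `ev_s : B[0,1] → B`. -/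
def ev {B : CXAlgebra X} (s : unitInterval) (b : B.interval) : B :=
  (show C(unitInterval, B) from b) s

/-! ### Asymptotic morphisms -/

/-- An asymptotic `C(X)`-morphism `{ψ_t}_{t ∈ [1,∞)} : A → B`: for every `a` the map
`t ↦ ψ_t(a)` is bounded and continuous, and the maps `ψ_t` satisfy the axioms of a
`C(X)`-linear ⋆-homomorphism in the limit `t → ∞`. -/
structure AsymptoticHom (A B : CXAlgebra X) where
  /-- The family; `toFun a t` is `ψ_t(a)`. -/
  toFun : A → (Set.Ici (1 : ℝ) →ᵇ B)
  asymp_add : ∀ a b, Tendsto (fun t => toFun (a + b) t - (toFun a t + toFun b t)) atTop (𝓝 0)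
  asymp_smul : ∀ (z : ℂ) (a), Tendsto (fun t => toFun (z • a) t - z • toFun a t) atTop (𝓝 0)
  asymp_mul : ∀ a b, Tendsto (fun t => toFun (a * b) t - toFun a t * toFun b t) atTop (𝓝 0)
  asymp_star : ∀ a, Tendsto (fun t => toFun (star a) t - star (toFun a t)) atTop (𝓝 0)
  asymp_action : ∀ (f : C(X, ℂ)) (a),
    Tendsto (fun t => toFun (f • a) t - f • toFun a t) atTop (𝓝 0)

instance (A B : CXAlgebra X) :
    CoeFun (AsymptoticHom A B) (fun _ => A → (Set.Ici (1 : ℝ) →ᵇ B)) :=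
  ⟨AsymptoticHom.toFun⟩

/-- The constant asymptotic morphism of a `C(X)`-morphism. -/
def AsymptoticHom.const {A B : CXAlgebra X} (φ : Hom A B) : AsymptoticHom A B where
  toFun a := BoundedContinuousFunction.const _ (φ.hom a)
  asymp_add a b := by simp
  asymp_smul z a := by simp
  asymp_mul a b := by simp
  asymp_star a := by simp [map_star φ.hom]
  asymp_action f a := by simp [φ.map_action']

/-- The composition `ψ_t ∘ φ` of an asymptotic morphism with a `C(X)`-morphism. -/
def AsymptoticHom.precomp {A A' B : CXAlgebra X} (ψ : AsymptoticHom A B) (φ : Hom A' A) :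
    AsymptoticHom A' B where
  toFun a := ψ (φ.hom a)
  asymp_add a b := by simpa using ψ.asymp_add (φ.hom a) (φ.hom b)
  asymp_smul z a := by simpa using ψ.asymp_smul z (φ.hom a)
  asymp_mul a b := by simpa using ψ.asymp_mul (φ.hom a) (φ.hom b)
  asymp_star a := by simpa [map_star φ.hom] using ψ.asymp_star (φ.hom a)
  asymp_action f a := by simpa [φ.map_action'] using ψ.asymp_action f (φ.hom a)

/-- Homotopy of asymptotic `C(X)`-morphisms, through an asymptotic `C(X)`-morphism
`A → B[0,1]`. -/
def Homotopic {A B : CXAlgebra X} (ψ₀ ψ₁ : AsymptoticHom A B) : Prop :=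
  ∃ Ψ : AsymptoticHom A B.interval, ∀ a t,
    ev 0 (Ψ a t) = ψ₀ a t ∧ ev 1 (Ψ a t) = ψ₁ a t

/-- `θ : S A → S B` is a suspension of `ψ : A → B`: asymptotically,
`θ_t (a ⊗ g) = ψ_t (a) ⊗ g`. This determines `θ` up to asymptotic equivalence. -/
def IsSuspension {A B : CXAlgebra X} (ψ : AsymptoticHom A B) (θ : AsymptoticHom A.susp B.susp) :
    Prop :=
  ∀ (a : A) (g : ZeroAtInftyContinuousMap ℝ ℂ),
    Tendsto (fun t => θ (tmul a g) t - tmul (ψ a t) g) atTop (𝓝 0)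

/-! ### Representable E-theory -/

/-- An asymptotic `C(X)`-morphism `Sⁿ(A ⊗ 𝓚) → Sⁿ(B ⊗ 𝓚)`. -/
abbrev ECycle (A B : CXAlgebra X) (n : ℕ) : Type u :=
  AsymptoticHom (A.stab.iterSusp n) (B.stab.iterSusp n)

/-- The relations of the direct limit: homotopic asymptotic morphisms are identified, and an
asymptotic morphism is identified with its suspensions. -/
inductive ERel (A B : CXAlgebra X) : (Σ n, ECycle A B n) → (Σ n, ECycle A B n) → Prop
  | homotopy (n : ℕ) (ψ₀ ψ₁ : ECycle A B n) (h : Homotopic ψ₀ ψ₁) : ERel A B ⟨n, ψ₀⟩ ⟨n, ψ₁⟩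
  | suspension (n : ℕ) (ψ : ECycle A B n) (θ : ECycle A B (n + 1)) (h : IsSuspension ψ θ) :
      ERel A B ⟨n, ψ⟩ ⟨n + 1, θ⟩

/-- The representable E-theory `RE(X; A, B)`, the direct limit over `n`, under suspension, of
the sets of homotopy classes of asymptotic `C(X)`-morphisms `Sⁿ(A ⊗ 𝓚) → Sⁿ(B ⊗ 𝓚)`. -/
def RE (A B : CXAlgebra X) : Type u := Quot (ERel A B)

/-- The class in `RE(X; A, B)` of an asymptotic morphism `Sⁿ(A ⊗ 𝓚) → Sⁿ(B ⊗ 𝓚)`. -/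
def RE.mk {A B : CXAlgebra X} (n : ℕ) (ψ : ECycle A B n) : RE A B := Quot.mk _ ⟨n, ψ⟩

/-- The class in `RE(X; A, B)` of a `C(X)`-morphism `A → B`. -/
def RE.ofHom {A B : CXAlgebra X} (φ : Hom A B) : RE A B := RE.mk 0 (AsymptoticHom.const φ.stab)

/-- The contravariant functoriality of `RE(X; -, B)` for `C(X)`-morphisms. -/
def RE.precomp {A A' B : CXAlgebra X} (φ : Hom A' A) : RE A B → RE A' B :=
  Quot.lift (fun c => RE.mk c.1 (c.2.precomp (φ.stab.iterSusp c.1))) <| by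
    rintro _ _ (⟨n, ψ₀, ψ₁, Ψ, h⟩ | ⟨n, ψ, θ, h⟩)
    · exact Quot.sound (.homotopy _ _ _ ⟨Ψ.precomp _, fun a t => h _ t⟩)
    · refine Quot.sound (.suspension _ _ _ fun a g => ?_)
      change Tendsto (fun t => θ (((φ.stab.iterSusp n).tensor _).hom (tmul a g)) t - _) _ _
      rw [HomOver.tensor_tmul]
      exact h _ g

/-- The fundamental class `[[A]]_X ∈ RE(X; C(X), A)` of a unital `C(X)`-algebra, the class of
the structural morphism. -/
def fundamentalClass (A : CXAlgebra X) (hA : A.IsUnital) : RE (base X) A :=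
  RE.ofHom (A.structural hA)

end CXAlgebra

/-! ### The asymptotic algebra `C_b([1,∞), F) / C_0([1,∞), F)` -/

section Asymptotic

variable {F : Type*} [NonUnitalCStarAlgebra F]

/-- The limes superior of the norm as `t → ∞`. -/
def limNorm (y : Set.Ici (1 : ℝ) →ᵇ F) : ℝ :=
  sInf {r : ℝ | 0 ≤ r ∧ ∀ᶠ t in atTop, ‖y t‖ ≤ r}

lemma limNorm_bddBelow (y : Set.Ici (1 : ℝ) →ᵇ F) :
    BddBelow {r : ℝ | 0 ≤ r ∧ ∀ᶠ t in atTop, ‖y t‖ ≤ r} := ⟨0, fun _ h => h.1⟩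

lemma limNorm_nonempty (y : Set.Ici (1 : ℝ) →ᵇ F) :
    {r : ℝ | 0 ≤ r ∧ ∀ᶠ t in atTop, ‖y t‖ ≤ r}.Nonempty :=
  ⟨‖y‖, norm_nonneg _, Eventually.of_forall fun t => y.norm_coe_le_norm t⟩

lemma limNorm_nonneg (y : Set.Ici (1 : ℝ) →ᵇ F) : 0 ≤ limNorm y :=
  Real.sInf_nonneg fun _ h => h.1

lemma limNorm_le {y : Set.Ici (1 : ℝ) →ᵇ F} {r : ℝ} (hr : 0 ≤ r)
    (h : ∀ᶠ t in atTop, ‖y t‖ ≤ r) : limNorm y ≤ r :=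
  csInf_le (limNorm_bddBelow y) ⟨hr, h⟩

lemma eventually_of_limNorm_lt {y : Set.Ici (1 : ℝ) →ᵇ F} {r : ℝ} (h : limNorm y < r) :
    ∀ᶠ t in atTop, ‖y t‖ ≤ r := by
  obtain ⟨s, hs, hsr⟩ := exists_lt_of_csInf_lt (limNorm_nonempty y) h
  filter_upwards [hs.2] with t ht using ht.trans hsr.le

lemma limNorm_add_le (x y : Set.Ici (1 : ℝ) →ᵇ F) : limNorm (x + y) ≤ limNorm x + limNorm y := by
  refine le_of_forall_pos_le_add fun ε hε => ?_
  have hx := eventually_of_limNorm_lt (y := x) (r := limNorm x + ε / 2) (by linarith)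
  have hy := eventually_of_limNorm_lt (y := y) (r := limNorm y + ε / 2) (by linarith)
  refine limNorm_le (by have := limNorm_nonneg x; have := limNorm_nonneg y; positivity) ?_
  filter_upwards [hx, hy] with t h1 h2
  have := norm_add_le (x t) (y t)
  rw [BoundedContinuousFunction.add_apply]
  linarith

lemma limNorm_mul_le (x y : Set.Ici (1 : ℝ) →ᵇ F) : limNorm (x * y) ≤ limNorm x * limNorm y := by
  refine le_mul_of_forall_lt₀ fun r hr s hs => ?_
  have hr0 := (limNorm_nonneg x).trans hr.le
  have hs0 := (limNorm_nonneg y).trans hs.le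
  refine limNorm_le (mul_nonneg hr0 hs0) ?_
  filter_upwards [eventually_of_limNorm_lt hr, eventually_of_limNorm_lt hs] with t h1 h2
  rw [BoundedContinuousFunction.mul_apply]
  exact (norm_mul_le _ _).trans (mul_le_mul h1 h2 (norm_nonneg _) hr0)

lemma limNorm_smul_le (z : ℂ) (y : Set.Ici (1 : ℝ) →ᵇ F) : limNorm (z • y) ≤ ‖z‖ * limNorm y := by
  refine le_mul_of_forall_lt₀ fun r hr s hs => ?_
  have hr0 := (norm_nonneg z).trans hr.le
  refine limNorm_le (mul_nonneg hr0 ((limNorm_nonneg y).trans hs.le)) ?_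
  filter_upwards [eventually_of_limNorm_lt hs] with t h2
  rw [BoundedContinuousFunction.smul_apply, norm_smul]
  exact mul_le_mul hr.le h2 (norm_nonneg _) hr0

lemma limNorm_star (y : Set.Ici (1 : ℝ) →ᵇ F) : limNorm (star y) = limNorm y := by
  simp [limNorm]

lemma limNorm_zero : limNorm (0 : Set.Ici (1 : ℝ) →ᵇ F) = 0 :=
  le_antisymm (limNorm_le le_rfl (by simp)) (limNorm_nonneg _)

variable (F) in
/-- `limsup ‖y t‖` as a C⋆-seminorm on `C_b([1,∞), F)`. -/
def asympSeminorm : CStarSeminorm (Set.Ici (1 : ℝ) →ᵇ F) where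
  toSeminorm := Seminorm.ofSMulLE limNorm limNorm_zero limNorm_add_le limNorm_smul_le
  mul_le' := limNorm_mul_le
  star_mul_self' x := by
    change limNorm (star x * x) = limNorm x ^ 2
    apply le_antisymm
    · refine (limNorm_mul_le _ _).trans ?_
      rw [limNorm_star, sq]
    · refine le_of_forall_gt_imp_ge_of_dense fun r hr => ?_
      have hr0 := (limNorm_nonneg _).trans hr.le
      have : limNorm x ≤ Real.sqrt r := by
        refine limNorm_le (Real.sqrt_nonneg r) ?_
        filter_upwards [eventually_of_limNorm_lt hr] with t ht
        refine Real.le_sqrt_of_sq_le ?_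
        rwa [BoundedContinuousFunction.mul_apply, BoundedContinuousFunction.star_apply,
          CStarRing.norm_star_mul_self, ← sq] at ht
      calc limNorm x ^ 2 ≤ Real.sqrt r ^ 2 := pow_le_pow_left₀ (limNorm_nonneg x) this 2
        _ = r := Real.sq_sqrt hr0

lemma asympSeminorm_apply (y : Set.Ici (1 : ℝ) →ᵇ F) : asympSeminorm F y = limNorm y := rfl

lemma limNorm_eq_zero_iff (y : Set.Ici (1 : ℝ) →ᵇ F) :
    limNorm y = 0 ↔ Tendsto (fun t => y t) atTop (𝓝 0) := by
  constructor
  · intro h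
    rw [NormedAddGroup.tendsto_nhds_zero]
    intro ε hε
    filter_upwards [eventually_of_limNorm_lt (y := y) (r := ε / 2) (by linarith)] with t ht
    linarith
  · intro h
    refine le_antisymm (le_of_forall_pos_le_add fun ε hε => ?_) (limNorm_nonneg y)
    rw [zero_add]
    refine limNorm_le hε.le ?_
    rw [NormedAddGroup.tendsto_nhds_zero] at h
    filter_upwards [h ε hε] with t ht using ht.le

lemma asymp_eq_iff (x y : Set.Ici (1 : ℝ) →ᵇ F) :
    (asympSeminorm F).toCompl x = (asympSeminorm F).toCompl y ↔
      Tendsto (fun t => x t - y t) atTop (𝓝 0) := by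
  rw [← sub_eq_zero, ← map_sub, ← norm_eq_zero, CStarSeminorm.norm_toCompl, asympSeminorm_apply,
    limNorm_eq_zero_iff]
  simp

lemma exists_bounded_lift (y : Set.Ici (1 : ℝ) →ᵇ F) {r : ℝ} (h : limNorm y < r) :
    ∃ x : Set.Ici (1 : ℝ) →ᵇ F,
      (asympSeminorm F).toCompl x = (asympSeminorm F).toCompl y ∧ ‖x‖ ≤ r := by
  obtain ⟨t₀, ht₀⟩ := eventually_atTop.1 (eventually_of_limNorm_lt h)
  refine ⟨y.compContinuous ⟨fun t => max t t₀, by fun_prop⟩, ?_, ?_⟩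
  · rw [asymp_eq_iff]
    refine tendsto_const_nhds.congr' ?_
    filter_upwards [eventually_ge_atTop t₀] with t ht
    simp [max_eq_left ht]
  · refine (BoundedContinuousFunction.norm_le ((limNorm_nonneg y).trans h.le)).2 fun t => ?_
    exact ht₀ _ (le_max_right _ _)

/-- The completion is already the quotient. -/
lemma asymp_surjective : Function.Surjective (asympSeminorm F).toCompl := by
  let f : NormedAddGroupHom (Set.Ici (1 : ℝ) →ᵇ F) (asympSeminorm F).Completion :=
    { toFun := (asympSeminorm F).toCompl
      map_add' := map_add _
      bound' := ⟨1, fun y => by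
        rw [CStarSeminorm.norm_toCompl, one_mul]
        exact limNorm_le (norm_nonneg _) (Eventually.of_forall fun t => y.norm_coe_le_norm t)⟩ }
  have h1 : f.SurjectiveOnWith f.range 2 := by
    intro h hh
    obtain ⟨y, rfl⟩ := (f.mem_range h).1 hh
    rcases (limNorm_nonneg y).eq_or_lt with h0 | h0
    · refine ⟨0, ?_, by simp⟩
      rw [map_zero]
      symm
      change (asympSeminorm F).toCompl y = 0
      rw [← norm_eq_zero, CStarSeminorm.norm_toCompl]; exact h0.symm
    · obtain ⟨x, hx, hxn⟩ := exists_bounded_lift y (r := 2 * limNorm y) (by linarith)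
      refine ⟨x, hx, ?_⟩
      have : ‖f y‖ = limNorm y := CStarSeminorm.norm_toCompl _ _
      rwa [this]
  have h2 := controlled_closure_of_complete two_pos one_pos h1
  intro z
  have hz : z ∈ f.range.topologicalClosure := by
    have : DenseRange f := (asympSeminorm F).denseRange_toCompl
    exact this z
  obtain ⟨y, hy, -⟩ := h2 z hz
  exact ⟨y, hy⟩

instance CXAction.asymptotic {Y : Type*} [TopologicalSpace Y] [CompactSpace Y] [CXAction Y F] :
    CXAction Y (Set.Ici (1 : ℝ) →ᵇ F) where
  toModule := inferInstance
  smul_assoc' z f d := by ext t; exact CXAction.smul_assoc' z f (d t)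
  smul_mul' f d e := by ext t; exact CXAction.smul_mul' f (d t) (e t)
  mul_smul' f d e := by ext t; exact CXAction.mul_smul' f (d t) (e t)
  star_smul' f d := by ext t; exact CXAction.star_smul' f (d t)

end Asymptotic

namespace CXAlgebra

variable {X Y : Type u} [TopologicalSpace X] [CompactSpace X] [TopologicalSpace Y]
  [CompactSpace Y]

/-- The `C(X)`-algebra `B_∞ = C_b([1,∞), B) / C_0([1,∞), B)`. -/
def inf (B : CXAlgebra X) : CXAlgebra X := ⟨(asympSeminorm B).Completion⟩

/-- The quotient map. -/
def toInf (B : CXAlgebra X) : (Set.Ici (1 : ℝ) →ᵇ B) →⋆ₙₐ[ℂ] B.inf := (asympSeminorm B).toCompl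

lemma toInf_eq_iff {B : CXAlgebra X} (x y : Set.Ici (1 : ℝ) →ᵇ B) :
    B.toInf x = B.toInf y ↔ Tendsto (fun t => x t - y t) atTop (𝓝 0) := asymp_eq_iff x y

lemma toInf_surjective (B : CXAlgebra X) : Function.Surjective B.toInf := asymp_surjective

lemma toInf_action {B : CXAlgebra X} (f : C(X, ℂ)) (y : Set.Ici (1 : ℝ) →ᵇ B) :
    B.toInf (f • y) = f • B.toInf y := ((asympSeminorm B).smul_toCompl f y).symm

lemma norm_toInf_le {B : CXAlgebra X} (y : Set.Ici (1 : ℝ) →ᵇ B) {r : ℝ} (hr : 0 ≤ r)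
    (h : ∀ t, ‖y t‖ ≤ r) : ‖B.toInf y‖ ≤ r := by
  refine (CStarSeminorm.norm_toCompl _ _).trans_le (limNorm_le hr (Eventually.of_forall h))

/-- The ⋆-homomorphism into `B_∞` of a family that is asymptotically a ⋆-homomorphism over
`p`. -/
def homInf {p : C(Y, X)} {A : CXAlgebra X} {B : CXAlgebra Y} (Φ : A → (Set.Ici (1 : ℝ) →ᵇ B))
    (hadd : ∀ a b, B.toInf (Φ (a + b)) = B.toInf (Φ a + Φ b))
    (hsmul : ∀ (z : ℂ) a, B.toInf (Φ (z • a)) = B.toInf (z • Φ a))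
    (hmul : ∀ a b, B.toInf (Φ (a * b)) = B.toInf (Φ a * Φ b))
    (hstar : ∀ a, B.toInf (Φ (star a)) = B.toInf (star (Φ a)))
    (hact : ∀ (f : C(X, ℂ)) a, B.toInf (Φ (f • a)) = B.toInf (f.comp p • Φ a)) :
    HomOver p A B.inf where
  hom :=
    { toFun := fun a => B.toInf (Φ a)
      map_smul' := fun z a => by rw [hsmul, map_smul]; rfl
      map_zero' := by have := hsmul 0 0; rwa [zero_smul, zero_smul, map_zero] at this
      map_add' := fun a b => by rw [hadd, map_add]
      map_mul' := fun a b => by rw [hmul, map_mul]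
      map_star' := fun a => by rw [hstar, map_star] }
  map_action f a := (hact f a).trans (toInf_action _ _)

/-- The `C(X)`-morphism `A → B_∞` of an asymptotic morphism. -/
def AsymptoticHom.hom {A B : CXAlgebra X} (ψ : AsymptoticHom A B) : Hom A B.inf :=
  homInf ψ
    (fun a b => (toInf_eq_iff _ _).2 (ψ.asymp_add a b))
    (fun z a => (toInf_eq_iff _ _).2 (ψ.asymp_smul z a))
    (fun a b => (toInf_eq_iff _ _).2 (ψ.asymp_mul a b))
    (fun a => (toInf_eq_iff _ _).2 (ψ.asymp_star a))
    (fun f a => (toInf_eq_iff _ _).2 (ψ.asymp_action f a))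

lemma AsymptoticHom.hom_apply {A B : CXAlgebra X} (ψ : AsymptoticHom A B) (a : A) :
    ψ.hom.hom a = B.toInf (ψ a) := rfl

/-- A family of lifts of a `C(X)`-morphism `A → B_∞` is an asymptotic morphism. -/
def AsymptoticHom.ofLift {A B : CXAlgebra X} (φ : Hom A B.inf) (Φ : A → (Set.Ici (1 : ℝ) →ᵇ B))
    (h : ∀ a, B.toInf (Φ a) = φ.hom a) : AsymptoticHom A B where
  toFun := Φ
  asymp_add a b := (toInf_eq_iff _ (Φ a + Φ b)).1 (by rw [map_add, h, h, h, map_add])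
  asymp_smul z a := (toInf_eq_iff _ (z • Φ a)).1 (by rw [map_smul, h, h, map_smul])
  asymp_mul a b := (toInf_eq_iff _ (Φ a * Φ b)).1 (by rw [map_mul, h, h, h, map_mul])
  asymp_star a := (toInf_eq_iff _ (star (Φ a))).1 (by rw [map_star, h, h, map_star])
  asymp_action f a := (toInf_eq_iff _ (f • Φ a)).1 (by
    rw [toInf_action, h, h, φ.map_action'])

/-- A morphism, as a continuous linear map. -/
def clm {A : CXAlgebra X} {B : CXAlgebra Y} (φ : A →⋆ₙₐ[ℂ] B) : A →L[ℂ] B :=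
  ⟨(φ : A →ₗ[ℂ] B), continuous_hom φ⟩

/-- Pointwise application of a ⋆-homomorphism. -/
def post {A : CXAlgebra X} {B : CXAlgebra Y} (φ : A →⋆ₙₐ[ℂ] B) :
    (Set.Ici (1 : ℝ) →ᵇ A) →L[ℂ] (Set.Ici (1 : ℝ) →ᵇ B) :=
  (clm φ).compLeftContinuousBounded _

lemma post_apply {A : CXAlgebra X} {B : CXAlgebra Y} (φ : A →⋆ₙₐ[ℂ] B)
    (y : Set.Ici (1 : ℝ) →ᵇ A) (t : Set.Ici (1 : ℝ)) : post φ y t = φ (y t) := rfl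

lemma post_congr {A : CXAlgebra X} {B : CXAlgebra Y} (φ : A →⋆ₙₐ[ℂ] B)
    {x y : Set.Ici (1 : ℝ) →ᵇ A} (h : A.toInf x = A.toInf y) :
    B.toInf (post φ x) = B.toInf (post φ y) := by
  rw [toInf_eq_iff] at h ⊢
  have h2 := ((continuous_hom φ).tendsto 0).comp h
  rw [map_zero] at h2
  refine h2.congr fun t => ?_
  simp [post_apply]

/-- The composition of an asymptotic morphism `D → E` with a morphism `E → F` over `p`. -/
def AsymptoticHom.compHom {p : C(Y, X)} {D E : CXAlgebra X} {F : CXAlgebra Y}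
    (ψ : AsymptoticHom D E) (K : HomOver p E F) : HomOver p D F.inf :=
  homInf (fun d => post K.hom (ψ d))
    (fun a b => by
      rw [post_congr K.hom (y := ψ a + ψ b) ((toInf_eq_iff _ _).2 (ψ.asymp_add a b)), map_add])
    (fun z a => by
      rw [post_congr K.hom (y := z • ψ a) ((toInf_eq_iff _ _).2 (ψ.asymp_smul z a)), map_smul])
    (fun a b => by
      rw [post_congr K.hom (y := ψ a * ψ b) ((toInf_eq_iff _ _).2 (ψ.asymp_mul a b))]
      congr 1; ext t; exact map_mul K.hom _ _)
    (fun a => by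
      rw [post_congr K.hom (y := star (ψ a)) ((toInf_eq_iff _ _).2 (ψ.asymp_star a))]
      congr 1; ext t; exact map_star K.hom _)
    (fun f a => by
      rw [post_congr K.hom (y := f • ψ a) ((toInf_eq_iff _ _).2 (ψ.asymp_action f a))]
      congr 1; ext t; exact K.map_action f _)

/-- The constant functions in `B[0,1]`. -/
def constInterval (B : CXAlgebra X) : Hom B B.interval where
  hom :=
    { toFun := fun b => (ContinuousMap.const unitInterval b : C(unitInterval, B))
      map_smul' := fun _ _ => rfl
      map_zero' := rfl
      map_add' := fun _ _ => rfl
      map_mul' := fun _ _ => rfl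
      map_star' := fun _ => rfl }
  map_action _ _ := rfl

lemma ev_constInterval {B : CXAlgebra X} (s : unitInterval) (b : B) :
    ev s ((constInterval B).hom b) = b := rfl

/-- The function `s ↦ s b`. -/
def ramp (B : CXAlgebra X) : B →L[ℂ] B.interval :=
  LinearMap.mkContinuous (F := C(unitInterval, B))
    { toFun := fun b => ⟨fun s => ((s : ℝ) : ℂ) • b, by fun_prop⟩
      map_add' := fun a b => by ext s; exact smul_add _ _ _
      map_smul' := fun z b => by ext s; exact smul_comm _ _ _ } 1 fun b => by
    refine (ContinuousMap.norm_le _ (by positivity)).2 fun s => ?_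
    change ‖((s : ℝ) : ℂ) • b‖ ≤ _
    rw [norm_smul, Complex.norm_real, Real.norm_of_nonneg s.2.1]
    exact mul_le_mul_of_nonneg_right s.2.2 (norm_nonneg b)

lemma ev_ramp {B : CXAlgebra X} (s : unitInterval) (b : B) :
    ev s (ramp B b) = ((s : ℝ) : ℂ) • b := rfl

lemma ev_add {B : CXAlgebra X} (s : unitInterval) (b c : B.interval) :
    ev s (b + c) = ev s b + ev s c := rfl

/-- Asymptotically equivalent morphisms are homotopic. -/
lemma homotopic_of_equiv {A B : CXAlgebra X} {ψ₀ ψ₁ : AsymptoticHom A B}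
    (h : ∀ a, B.toInf (ψ₀ a) = B.toInf (ψ₁ a)) : Homotopic ψ₀ ψ₁ := by
  let Φ : A → (Set.Ici (1 : ℝ) →ᵇ B.interval) := fun a =>
    post (constInterval B).hom (ψ₀ a) +
      (ramp B).compLeftContinuousBounded _ (ψ₁ a - ψ₀ a)
  refine ⟨AsymptoticHom.ofLift (ψ₀.compHom (constInterval B)) Φ fun a => ?_, fun a t => ?_⟩
  · change _ = B.interval.toInf (post (constInterval B).hom (ψ₀ a))
    rw [toInf_eq_iff]
    have h1 := (toInf_eq_iff _ _).1 (h a).symm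
    have h2 := ((ramp B).continuous.tendsto 0).comp h1
    rw [map_zero] at h2
    refine h2.congr fun t => ?_
    simp [Φ]
  · change ev 0 ((constInterval B).hom (ψ₀ a t) + ramp B (ψ₁ a t - ψ₀ a t)) = _ ∧
      ev 1 ((constInterval B).hom (ψ₀ a t) + ramp B (ψ₁ a t - ψ₀ a t)) = _
    rw [ev_add, ev_add, ev_constInterval, ev_constInterval, ev_ramp, ev_ramp]
    simp

end CXAlgebra

/-! ### The universal property of pullbacks -/

lemma CStar.exists_approximateUnit (C : Type*) [NonUnitalCStarAlgebra C] :
    ∃ l : Filter C, l.NeBot ∧ (∀ᶠ e in l, ‖e‖ ≤ 1) ∧ ∀ c : C, Tendsto (· * c) l (𝓝 c) := by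
  let _ := CStarAlgebra.spectralOrder C
  have := CStarAlgebra.spectralOrderedRing C
  have h := CStarAlgebra.increasingApproximateUnit C
  exact ⟨CStarAlgebra.approximateUnit C, h.neBot, h.eventually_norm, h.tendsto_mul_right⟩

namespace CXAlgebra

variable {X Y : Type u} [TopologicalSpace X] [CompactSpace X] [TopologicalSpace Y]
  [CompactSpace Y]

/-- The property that characterizes the canonical map `D → p^* D` up to isomorphism. -/
structure IsPullbackModel {p : C(Y, X)} {D : CXAlgebra X} {D' : CXAlgebra Y}
    (J : HomOver p D D') : Prop where
  ind : ∀ P : D' → Prop, IsClosed {x | P x} → P 0 → (∀ x y, P x → P y → P (x + y)) →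
    (∀ (g : C(Y, ℂ)) (d : D), P (g • J.hom d)) → ∀ x, P x
  ext : ∀ (F : CXAlgebra Y) (φ : HomOver p D F), ∃ φ' : Hom D' F, ∀ d,
    φ'.hom (J.hom d) = φ.hom d

section Unit

variable {p : C(Y, X)} {A : CXAlgebra X} {F : CXAlgebra Y} (φ : HomOver p A F)

/-- The bilinear map `(g, a) ↦ g • φ a`. -/
def unitBilin : C(Y, ℂ) →ₗ[ℂ] A →ₗ[ℂ] F :=
  LinearMap.mk₂ ℂ (fun g a => g • φ.hom a) (fun g h a => add_smul _ _ _)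
    (fun z g a => CXAction.smul_assoc' _ _ _) (fun g a b => by rw [map_add, smul_add])
    (fun z g a => by rw [map_smul, CXAction.smul_comm_complex])

lemma unitBilin_apply (g : C(Y, ℂ)) (a : A) : unitBilin φ g a = g • φ.hom a := rfl

/-- The ⋆-homomorphism `p^* A → F`, `g ⊗ a ↦ g • φ a`. -/
def unitLift : A.pullback p →⋆ₙₐ[ℂ] F :=
  MaxTensor.lift (pullbackRel p A) (unitBilin φ)
    (fun g h a b => by
      simp only [unitBilin_apply]
      rw [map_mul, CXAction.smul_mul', CXAction.mul_smul', smul_smul])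
    (fun g a => by
      simp only [unitBilin_apply]
      rw [map_star, CXAction.star_smul'])
    (fun g a => (CXAction.norm_smul_le _ _).trans
      (mul_le_mul_of_nonneg_left (MaxTensor.norm_hom_le φ.hom a) (norm_nonneg g)))
    (by
      rintro _ ⟨f, g, a, rfl⟩
      rw [map_sub, TensorProduct.lift.tmul, TensorProduct.lift.tmul, unitBilin_apply,
        unitBilin_apply, φ.map_action, smul_smul, mul_comm, sub_self])

lemma unitLift_mk (g : C(Y, ℂ)) (a : A) : unitLift φ (pullbackMk p g a) = g • φ.hom a :=
  MaxTensor.lift_tmul _ _ _ _ _ _ _ _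

end Unit

lemma smul_pullbackUnit (p : C(Y, X)) {A : CXAlgebra X} (g : C(Y, ℂ)) (a : A) :
    g • (pullbackUnit p A).hom a = pullbackMk p g a := by
  rw [pullbackUnit_apply, action_pullbackMk, mul_one]

lemma isPullbackModel_pullbackUnit (p : C(Y, X)) (A : CXAlgebra X) :
    IsPullbackModel (pullbackUnit p A) where
  ind P hc h0 hadd h x := by
    induction x using pullback_ind with
    | hc => exact hc
    | h0 => exact h0
    | hadd x y hx hy => exact hadd x y hx hy
    | ht g a => rw [← smul_pullbackUnit]; exact h g a
  ext F φ := by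
    refine ⟨⟨unitLift φ, fun f x => ?_⟩, fun a => ?_⟩
    · change unitLift φ (f • x) = f • unitLift φ x
      induction x using pullback_ind with
      | hc =>
        exact isClosed_eq ((continuous_hom _).comp (continuous_action f))
          ((continuous_action _).comp (continuous_hom _))
      | h0 => rw [smul_zero, map_zero, smul_zero]
      | hadd x y hx hy => rw [smul_add, map_add, map_add, smul_add, hx, hy]
      | ht g a => rw [action_pullbackMk, unitLift_mk, unitLift_mk, mul_smul]
    · change unitLift φ (pullbackMk p 1 a) = _
      rw [unitLift_mk, one_smul]

section Slice

variable {p : C(Y, X)} {D : CXAlgebra X} {C : Type} [NonUnitalCStarAlgebra C] {F : CXAlgebra Y}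
  (φ : HomOver p (D.tensor C) F)

/-- The bounded linear map `c ↦ g • φ (d ⊗ c)`. -/
def sliceAux (g : C(Y, ℂ)) (d : D) : C →L[ℂ] F :=
  LinearMap.mkContinuous
    { toFun := fun c => g • φ.hom (tmul d c)
      map_add' := fun c c' => by
        rw [show tmul d (c + c') = tmul d c + tmul d c' from MaxTensor.tmul_add _ _ _ _, map_add,
          smul_add]
      map_smul' := fun z c => by
        rw [show tmul d (z • c) = z • tmul d c from MaxTensor.tmul_smul _ _ _ _, map_smul,
          CXAction.smul_comm_complex]; rfl } (‖g‖ * ‖d‖) fun c => by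
    refine (CXAction.norm_smul_le _ _).trans ?_
    rw [mul_assoc]
    exact mul_le_mul_of_nonneg_left
      ((MaxTensor.norm_hom_le φ.hom _).trans (MaxTensor.norm_tmul_le _ _ _)) (norm_nonneg g)

lemma sliceAux_apply (g : C(Y, ℂ)) (d : D) (c : C) :
    sliceAux φ g d c = g • φ.hom (tmul d c) := rfl

/-- The linear map `g ⊗ d ↦ (c ↦ g • φ (d ⊗ c))`. -/
def slice : C(Y, ℂ) ⊗[ℂ] D →ₗ[ℂ] (C →L[ℂ] F) :=
  TensorProduct.lift <| LinearMap.mk₂ ℂ (sliceAux φ)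
    (fun g h d => by ext c; exact add_smul _ _ _)
    (fun z g d => by ext c; exact CXAction.smul_assoc' _ _ _)
    (fun g d e => by
      ext c
      change g • φ.hom (tmul (d + e) c) = g • φ.hom (tmul d c) + g • φ.hom (tmul e c)
      rw [show tmul (d + e) c = tmul d c + tmul e c from MaxTensor.add_tmul _ _ _ _, map_add,
        smul_add])
    (fun z g d => by
      ext c
      change g • φ.hom (tmul (z • d) c) = z • (g • φ.hom (tmul d c))
      rw [show tmul (z • d) c = z • tmul d c from MaxTensor.smul_tmul _ _ _ _, map_smul,
          CXAction.smul_comm_complex])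

lemma slice_tmul (g : C(Y, ℂ)) (d : D) (c : C) :
    slice φ (g ⊗ₜ d) c = g • φ.hom (tmul d c) := rfl

lemma slice_mul (z w : C(Y, ℂ) ⊗[ℂ] D) (c c' : C) :
    slice φ (z * w) (c * c') = slice φ z c * slice φ w c' := by
  induction z using TensorProduct.induction_on with
  | zero => simp
  | add x y hx hy =>
    rw [add_mul, map_add, map_add, _root_.add_apply, _root_.add_apply,
      add_mul, hx, hy]
  | tmul g d =>
    induction w using TensorProduct.induction_on with
    | zero => simp
    | add x y hx hy =>
      rw [mul_add, map_add, map_add, _root_.add_apply,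
        _root_.add_apply, mul_add, hx, hy]
    | tmul h e =>
      rw [Algebra.TensorProduct.tmul_mul_tmul, slice_tmul, slice_tmul, slice_tmul,
        CXAction.smul_mul', CXAction.mul_smul', smul_smul, ← map_mul]
      congr 2
      exact (MaxTensor.tmul_mul _ _ _ _ _).symm

lemma slice_star (z : C(Y, ℂ) ⊗[ℂ] D) (c : C) :
    slice φ (star z) (star c) = star (slice φ z c) := by
  induction z using TensorProduct.induction_on with
  | zero => simp
  | add x y hx hy =>
    rw [star_add, map_add, map_add, _root_.add_apply, _root_.add_apply,
      star_add, hx, hy]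
  | tmul g d =>
    rw [TensorProduct.star_tmul, slice_tmul, slice_tmul, CXAction.star_smul', ← map_star]
    congr 2
    exact (MaxTensor.star_tmul _ _ _).symm

lemma slice_action (h : C(Y, ℂ)) (z : C(Y, ℂ) ⊗[ℂ] D) (c : C) :
    slice φ (h • z) c = h • slice φ z c := by
  induction z using TensorProduct.induction_on with
  | zero => simp
  | add x y hx hy =>
    rw [smul_add, map_add, map_add, _root_.add_apply, _root_.add_apply,
      smul_add, hx, hy]
  | tmul g d =>
    change slice φ ((h * g) ⊗ₜ d) c = _
    rw [slice_tmul, slice_tmul, mul_smul]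

lemma norm_slice_mul_le (z w : C(Y, ℂ) ⊗[ℂ] D) :
    ‖slice φ (z * w)‖ ≤ ‖slice φ z‖ * ‖slice φ w‖ := by
  refine ContinuousLinearMap.opNorm_le_bound _ (by positivity) fun c => ?_
  obtain ⟨l, hl, h1, h2⟩ := CStar.exists_approximateUnit C
  have h3 := (((slice φ (z * w)).continuous.tendsto c).comp (h2 c)).norm
  refine le_of_tendsto h3 ?_
  filter_upwards [h1] with e he
  change ‖slice φ (z * w) (e * c)‖ ≤ _
  rw [slice_mul, mul_assoc]
  refine (norm_mul_le _ _).trans (mul_le_mul ?_ ((slice φ w).le_opNorm c) (norm_nonneg _)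
    (norm_nonneg _))
  exact ((slice φ z).le_opNorm e).trans (mul_le_of_le_one_right (norm_nonneg _) he)

lemma norm_slice_star_le (z : C(Y, ℂ) ⊗[ℂ] D) : ‖slice φ (star z)‖ ≤ ‖slice φ z‖ := by
  refine ContinuousLinearMap.opNorm_le_bound _ (norm_nonneg _) fun c => ?_
  have h := slice_star φ z (star c)
  rw [star_star] at h
  rw [h, norm_star, ← norm_star c]
  exact (slice φ z).le_opNorm _

/-- The C⋆-seminorm `z ↦ ‖slice z‖`. -/
def sliceSeminorm : CStarSeminorm (C(Y, ℂ) ⊗[ℂ] D) where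
  toSeminorm := (normSeminorm ℂ (C →L[ℂ] F)).comp (slice φ)
  mul_le' := norm_slice_mul_le φ
  star_mul_self' z := by
    change ‖slice φ (star z * z)‖ = ‖slice φ z‖ ^ 2
    apply le_antisymm
    · refine (norm_slice_mul_le φ _ _).trans ?_
      rw [sq]
      exact mul_le_mul_of_nonneg_right (norm_slice_star_le φ z) (norm_nonneg _)
    · rw [← Real.le_sqrt (norm_nonneg _) (norm_nonneg _)]
      refine ContinuousLinearMap.opNorm_le_bound _ (Real.sqrt_nonneg _) fun c => ?_
      refine abs_le_of_sq_le_sq' ?_ (by positivity) |>.2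
      rw [mul_pow, Real.sq_sqrt (norm_nonneg _), sq, ← CStarRing.norm_star_mul_self, ← slice_star,
        ← slice_mul, sq, ← CStarRing.norm_star_mul_self]
      exact (slice φ (star z * z)).le_opNorm _

lemma sliceSeminorm_apply (z : C(Y, ℂ) ⊗[ℂ] D) : sliceSeminorm φ z = ‖slice φ z‖ := rfl

/-- The image of `C(Y) ⊙ D` in the multipliers of `F`. -/
def sliceAlg : CXAlgebra Y := ⟨(sliceSeminorm φ).Completion⟩

/-- The canonical map. -/
def toSlice : C(Y, ℂ) ⊗[ℂ] D →⋆ₙₐ[ℂ] sliceAlg φ := (sliceSeminorm φ).toCompl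

lemma toSlice_action (g : C(Y, ℂ)) (z : C(Y, ℂ) ⊗[ℂ] D) :
    toSlice φ (g • z) = g • toSlice φ z := ((sliceSeminorm φ).smul_toCompl g z).symm

lemma toSlice_eq_iff (z w : C(Y, ℂ) ⊗[ℂ] D) :
    toSlice φ z = toSlice φ w ↔ slice φ z = slice φ w := by
  rw [← sub_eq_zero, ← map_sub, ← norm_eq_zero]
  change ‖(sliceSeminorm φ).toCompl (z - w)‖ = 0 ↔ _
  rw [CStarSeminorm.norm_toCompl, sliceSeminorm_apply, norm_eq_zero, map_sub, sub_eq_zero]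

@[elab_as_elim]
lemma slice_ind {P : sliceAlg φ → Prop} (x : sliceAlg φ) (hc : IsClosed {x | P x})
    (h : ∀ d, P (toSlice φ d)) : P x :=
  CStarSeminorm.ind (N := sliceSeminorm φ) x hc h

/-- The map `d ↦ 1 ⊗ d`. -/
def sliceUnit : HomOver p D (sliceAlg φ) where
  hom :=
    { toFun := fun d => toSlice φ (1 ⊗ₜ d)
      map_smul' := fun z d => by rw [TensorProduct.tmul_smul, map_smul]; rfl
      map_zero' := by rw [TensorProduct.tmul_zero, map_zero]
      map_add' := fun a b => by rw [TensorProduct.tmul_add, map_add]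
      map_mul' := fun a b => by
        rw [← map_mul, Algebra.TensorProduct.tmul_mul_tmul, one_mul]
      map_star' := fun a => by rw [← map_star, TensorProduct.star_tmul, star_one] }
  map_action f a := by
    change toSlice φ (1 ⊗ₜ (f • a)) = f.comp p • toSlice φ (1 ⊗ₜ a)
    rw [← toSlice_action, toSlice_eq_iff]
    ext c
    rw [slice_action, slice_tmul, slice_tmul, ← action_tmul, φ.map_action, one_smul, one_smul]

/-- The extension of `slice` to the completion. -/
def sliceExt : sliceAlg φ →L[ℂ] (C →L[ℂ] F) :=
  (sliceSeminorm φ).liftCLM (slice φ) 1 fun x => by rw [one_mul, sliceSeminorm_apply]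

lemma sliceExt_toSlice (z : C(Y, ℂ) ⊗[ℂ] D) : sliceExt φ (toSlice φ z) = slice φ z :=
  (sliceSeminorm φ).liftCLM_toCompl _ _ _ z

lemma continuous_sliceExt (c : C) : Continuous fun x => sliceExt φ x c :=
  (ContinuousLinearMap.apply ℂ F c).continuous.comp (sliceExt φ).continuous

lemma sliceExt_mul (x y : sliceAlg φ) (c c' : C) :
    sliceExt φ (x * y) (c * c') = sliceExt φ x c * sliceExt φ y c' := by
  induction x using slice_ind with
  | hc =>
    exact isClosed_eq ((continuous_sliceExt φ _).comp (continuous_id.mul continuous_const))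
      ((continuous_sliceExt φ _).mul continuous_const)
  | h z =>
    induction y using slice_ind with
    | hc =>
      exact isClosed_eq ((continuous_sliceExt φ _).comp (continuous_const.mul continuous_id))
        (continuous_const.mul (continuous_sliceExt φ _))
    | h w =>
      rw [← map_mul, sliceExt_toSlice, sliceExt_toSlice, sliceExt_toSlice, slice_mul]

lemma sliceExt_star (x : sliceAlg φ) (c : C) :
    sliceExt φ (star x) (star c) = star (sliceExt φ x c) := by
  induction x using slice_ind with
  | hc =>
    exact isClosed_eq ((continuous_sliceExt φ _).comp continuous_star)
      (continuous_star.comp (continuous_sliceExt φ _))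
  | h z => rw [← map_star, sliceExt_toSlice, sliceExt_toSlice, slice_star]

lemma sliceExt_action (g : C(Y, ℂ)) (x : sliceAlg φ) (c : C) :
    sliceExt φ (g • x) c = g • sliceExt φ x c := by
  induction x using slice_ind with
  | hc =>
    exact isClosed_eq ((continuous_sliceExt φ _).comp (continuous_action g))
      ((continuous_action g).comp (continuous_sliceExt φ _))
  | h z => rw [← toSlice_action, sliceExt_toSlice, sliceExt_toSlice, slice_action]

lemma norm_sliceExt_le (x : sliceAlg φ) : ‖sliceExt φ x‖ ≤ ‖x‖ := by
  induction x using slice_ind with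
  | hc => exact isClosed_le (sliceExt φ).continuous.norm continuous_norm
  | h z =>
    rw [sliceExt_toSlice]
    exact (CStarSeminorm.norm_toCompl (sliceSeminorm φ) z).ge

variable {D' : CXAlgebra Y} (χ : Hom D' (sliceAlg φ))

/-- The bilinear map `(x, c) ↦ χ(x) c`. -/
def sliceBilin : D' →ₗ[ℂ] C →ₗ[ℂ] F :=
  LinearMap.mk₂ ℂ (fun x c => sliceExt φ (χ.hom x) c)
    (fun x y c => by rw [map_add, map_add]; rfl) (fun z x c => by rw [map_smul, map_smul]; rfl)
    (fun x c c' => map_add _ _ _) (fun z x c => map_smul _ _ _)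

lemma sliceBilin_apply (x : D') (c : C) : sliceBilin φ χ x c = sliceExt φ (χ.hom x) c := rfl

/-- The ⋆-homomorphism `x ⊗ c ↦ χ(x) c`. -/
def sliceLift : D'.tensor C →⋆ₙₐ[ℂ] F :=
  MaxTensor.lift ∅ (sliceBilin φ χ)
    (fun x y c c' => by
      rw [sliceBilin_apply, sliceBilin_apply, sliceBilin_apply, map_mul χ.hom, sliceExt_mul])
    (fun x c => by rw [sliceBilin_apply, sliceBilin_apply, map_star χ.hom, sliceExt_star])
    (fun x c => by
      rw [sliceBilin_apply]
      refine (ContinuousLinearMap.le_opNorm _ _).trans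
        (mul_le_mul_of_nonneg_right ?_ (norm_nonneg _))
      exact (norm_sliceExt_le φ _).trans (MaxTensor.norm_hom_le χ.hom x))
    (fun _ h => h.elim)

lemma sliceLift_tmul (x : D') (c : C) :
    sliceLift φ χ (tmul x c) = sliceExt φ (χ.hom x) c := MaxTensor.lift_tmul _ _ _ _ _ _ _ _

end Slice

lemma continuous_tmul {A : CXAlgebra X} {C : Type} [NonUnitalCStarAlgebra C] (c : C) :
    Continuous fun a : A => tmul a c :=
  AddMonoidHomClass.continuous_of_bound
    (⟨⟨fun a : A => tmul a c, MaxTensor.zero_tmul _ _⟩,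
      fun a b => MaxTensor.add_tmul _ _ _ _⟩ : A →+ A.tensor C) ‖c‖ fun a => by
    rw [mul_comm]; exact MaxTensor.norm_tmul_le _ _ _

/-- Pullback models are stable under tensor products. -/
lemma IsPullbackModel.tensor {p : C(Y, X)} {D : CXAlgebra X} {D' : CXAlgebra Y}
    {J : HomOver p D D'} (hJ : IsPullbackModel J) (C : Type) [NonUnitalCStarAlgebra C] :
    IsPullbackModel (J.tensor C) where
  ind P hc h0 hadd h x := by
    induction x using tensor_ind with
    | hc => exact hc
    | h0 => exact h0
    | hadd x y hx hy => exact hadd x y hx hy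
    | ht x c =>
      refine hJ.ind (fun x => P (tmul x c)) (hc.preimage (continuous_tmul c)) ?_ ?_ ?_ x
      · change P (MaxTensor.tmul ∅ 0 c); rw [MaxTensor.zero_tmul]; exact h0
      · intro x y hx hy
        rw [show tmul (x + y) c = tmul x c + tmul y c from MaxTensor.add_tmul _ _ _ _]
        exact hadd _ _ hx hy
      · intro g d
        rw [← action_tmul, ← HomOver.tensor_tmul]
        exact h _ _
  ext F φ := by
    obtain ⟨χ, hχ⟩ := hJ.ext (sliceAlg φ) (sliceUnit φ)
    refine ⟨⟨sliceLift φ χ, fun f x => ?_⟩, fun x => ?_⟩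
    · change sliceLift φ χ (f • x) = f • sliceLift φ χ x
      induction x using tensor_ind with
      | hc =>
        exact isClosed_eq ((continuous_hom _).comp (continuous_action f))
          ((continuous_action _).comp (continuous_hom _))
      | h0 => rw [smul_zero, map_zero, smul_zero]
      | hadd x y hx hy => rw [smul_add, map_add, map_add, smul_add, hx, hy]
      | ht x c =>
        rw [action_tmul, sliceLift_tmul, sliceLift_tmul, Hom.map_action', sliceExt_action]
    · change sliceLift φ χ ((J.tensor C).hom x) = φ.hom x
      induction x using tensor_ind with
      | hc =>
        exact isClosed_eq ((continuous_hom _).comp (continuous_hom _)) (continuous_hom _)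
      | h0 => rw [map_zero, map_zero, map_zero]
      | hadd x y hx hy => rw [map_add, map_add, map_add, hx, hy]
      | ht d c =>
        rw [HomOver.tensor_tmul, sliceLift_tmul, hχ]
        change sliceExt φ (toSlice φ (1 ⊗ₜ d)) c = _
        rw [sliceExt_toSlice, slice_tmul, one_smul]

/-- The canonical map `Sⁿ(A ⊗ 𝓚) → Sⁿ(p^* A ⊗ 𝓚)`. -/
def cycleUnit (p : C(Y, X)) (A : CXAlgebra X) (n : ℕ) :
    HomOver p (A.stab.iterSusp n) ((A.pullback p).stab.iterSusp n) :=
  (pullbackUnit p A).stab.iterSusp n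

/-- The algebra `Sⁿ(p^* A ⊗ 𝓚)` is the pullback of `Sⁿ(A ⊗ 𝓚)`. -/
lemma isPullbackModel_cycleUnit (p : C(Y, X)) (A : CXAlgebra X) (n : ℕ) :
    IsPullbackModel (cycleUnit p A n) := by
  induction n with
  | zero => exact (isPullbackModel_pullbackUnit p A).tensor _
  | succ n ih => exact ih.tensor _

end CXAlgebra

/-! ### The pullback transformation -/

namespace CXAlgebra

variable {X Y : Type u} [TopologicalSpace X] [CompactSpace X] [TopologicalSpace Y]
  [CompactSpace Y]

/-- `θ` extends `ψ` along maps `J : D → D'` and `K : E → E'` over `p`: asymptotically,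
`θ_t (g • J d) = g • K (ψ_t (d))`. For the canonical maps `D → p^* D` and `E → p^* E` this
says that `θ` is the asymptotic morphism `id ⊗ ψ` from `C(Y) ⊗_X D` to `C(Y) ⊗_X E`. -/
def IsExtension {p : C(Y, X)} {D E : CXAlgebra X} {D' E' : CXAlgebra Y} (J : HomOver p D D')
    (K : HomOver p E E') (ψ : AsymptoticHom D E) (θ : AsymptoticHom D' E') : Prop :=
  ∀ (g : C(Y, ℂ)) (d : D),
    Tendsto (fun t => θ (g • J.hom d) t - g • K.hom (ψ d t)) atTop (𝓝 0)

section Extension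

variable {p : C(Y, X)} {D E : CXAlgebra X} {D' E' : CXAlgebra Y} {J : HomOver p D D'}
    {K : HomOver p E E'} {ψ : AsymptoticHom D E} {θ θ' : AsymptoticHom D' E'}

lemma isExtension_iff : IsExtension J K ψ θ ↔
    ∀ d, θ.hom.hom (J.hom d) = E'.toInf (post K.hom (ψ d)) := by
  have key : IsExtension J K ψ θ ↔ ∀ (g : C(Y, ℂ)) (d : D),
      θ.hom.hom (g • J.hom d) = E'.toInf (g • post K.hom (ψ d)) :=
    forall₂_congr fun g d => (toInf_eq_iff _ (g • post K.hom (ψ d))).symm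
  rw [key]
  constructor
  · intro h d
    have := h 1 d
    rwa [one_smul, one_smul] at this
  · intro h g d
    rw [Hom.map_action', h, toInf_action]

lemma IsPullbackModel.exists_extension (hJ : IsPullbackModel J) (K : HomOver p E E')
    (ψ : AsymptoticHom D E) : ∃ θ : AsymptoticHom D' E', IsExtension J K ψ θ := by
  obtain ⟨φ', hφ⟩ := hJ.ext E'.inf (ψ.compHom K)
  choose Φ hΦ using fun x => E'.toInf_surjective (φ'.hom x)
  refine ⟨AsymptoticHom.ofLift φ' Φ hΦ, isExtension_iff.2 fun d => ?_⟩
  exact (hΦ _).trans (hφ d)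

lemma IsPullbackModel.extension_unique (hJ : IsPullbackModel J) (h : IsExtension J K ψ θ)
    (h' : IsExtension J K ψ θ') (x : D') : E'.toInf (θ x) = E'.toInf (θ' x) := by
  rw [isExtension_iff] at h h'
  refine hJ.ind (fun x => θ.hom.hom x = θ'.hom.hom x)
    (isClosed_eq (continuous_hom _) (continuous_hom _)) ?_ ?_ ?_ x
  · change θ.hom.hom 0 = θ'.hom.hom 0
    rw [map_zero, map_zero]
  · intro x y hx hy
    change θ.hom.hom (x + y) = θ'.hom.hom (x + y)
    rw [map_add, map_add, hx, hy]
  · intro g d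
    change θ.hom.hom (g • J.hom d) = θ'.hom.hom (g • J.hom d)
    rw [Hom.map_action', Hom.map_action', h, h']

lemma IsPullbackModel.homotopic (hJ : IsPullbackModel J) (h : IsExtension J K ψ θ)
    (h' : IsExtension J K ψ θ') : Homotopic θ θ' :=
  homotopic_of_equiv (hJ.extension_unique h h')

/-- The evaluation, as a morphism. -/
def evHom (B : CXAlgebra X) (s : unitInterval) : Hom B.interval B where
  hom :=
    { toFun := ev s
      map_smul' := fun _ _ => rfl
      map_zero' := rfl
      map_add' := fun _ _ => rfl
      map_mul' := fun _ _ => rfl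
      map_star' := fun _ => rfl }
  map_action _ _ := rfl

/-- The map `K[0,1] : E[0,1] → E'[0,1]`. -/
def HomOver.interval (K : HomOver p E E') : HomOver p E.interval E'.interval where
  hom :=
    { toFun := fun b => ((⟨K.hom, continuous_hom K.hom⟩ : C(E, E')).comp
        (show C(unitInterval, E) from b) : C(unitInterval, E'))
      map_smul' := fun z b => ContinuousMap.ext fun s => map_smul K.hom z (ev s b)
      map_zero' := ContinuousMap.ext fun _ => map_zero K.hom
      map_add' := fun b c => ContinuousMap.ext fun s => map_add K.hom (ev s b) (ev s c)
      map_mul' := fun b c => ContinuousMap.ext fun s => map_mul K.hom (ev s b) (ev s c)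
      map_star' := fun b => ContinuousMap.ext fun s => map_star K.hom (ev s b) }
  map_action f b := ContinuousMap.ext fun s => K.map_action f (ev s b)

lemma HomOver.ev_interval (K : HomOver p E E') (s : unitInterval) (b : E.interval) :
    ev s (K.interval.hom b) = K.hom (ev s b) := rfl

/-- The evaluation of an asymptotic morphism `D → E[0,1]`. -/
def AsymptoticHom.evalAt (Θ : AsymptoticHom D E.interval) (s : unitInterval) :
    AsymptoticHom D E :=
  AsymptoticHom.ofLift (Θ.compHom (evHom E s)) (fun x => post (evHom E s).hom (Θ x))
    fun _ => rfl

lemma IsExtension.evalAt {Ψ : AsymptoticHom D E.interval} {Θ : AsymptoticHom D' E'.interval}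
    (h : IsExtension J K.interval Ψ Θ) (s : unitInterval) (hψ : ∀ d t, ev s (Ψ d t) = ψ d t) :
    IsExtension J K ψ (Θ.evalAt s) := by
  rw [isExtension_iff] at h ⊢
  intro d
  refine (post_congr (evHom E' s).hom (h d)).trans (congrArg E'.toInf ?_)
  ext t
  change ev s (K.interval.hom (Ψ d t)) = K.hom (ψ d t)
  rw [HomOver.ev_interval, hψ]

/-- The map `b ↦ b ⊗ c`. -/
def tmulRight (B : CXAlgebra X) {C : Type} [NonUnitalCStarAlgebra C] (c : C) :
    B →L[ℂ] B.tensor C :=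
  LinearMap.mkContinuous
    { toFun := fun b => tmul b c
      map_add' := fun _ _ => MaxTensor.add_tmul _ _ _ _
      map_smul' := fun _ _ => MaxTensor.smul_tmul _ _ _ _ } ‖c‖
    fun b => by rw [mul_comm]; exact MaxTensor.norm_tmul_le _ _ _

lemma tmulRight_apply (B : CXAlgebra X) {C : Type} [NonUnitalCStarAlgebra C] (c : C) (b : B) :
    tmulRight B c b = tmul b c := rfl

lemma norm_tmulRight_le (B : CXAlgebra X) {C : Type} [NonUnitalCStarAlgebra C] (c : C) (b : B) :
    ‖tmulRight B c b‖ ≤ ‖b‖ * ‖c‖ := MaxTensor.norm_tmul_le _ _ _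

/-- Pointwise `b ↦ b ⊗ c`, with values in the asymptotic algebra. -/
def tmulInfAux (B : CXAlgebra X) {C : Type} [NonUnitalCStarAlgebra C] (c : C) :
    (Set.Ici (1 : ℝ) →ᵇ B) →ₗ[ℂ] (B.tensor C).inf where
  toFun y := (B.tensor C).toInf ((tmulRight B c).compLeftContinuousBounded _ y)
  map_add' x y := by rw [map_add, map_add]
  map_smul' z y := by rw [map_smul, map_smul]; rfl

/-- The map `[y] ↦ [y ⊗ c]` of asymptotic algebras. -/
def tmulInf (B : CXAlgebra X) {C : Type} [NonUnitalCStarAlgebra C] (c : C) :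
    B.inf →L[ℂ] (B.tensor C).inf :=
  (asympSeminorm B).liftCLM (tmulInfAux B c) ‖c‖ fun y => by
    refine (CStarSeminorm.norm_toCompl (asympSeminorm (B.tensor C)) _).trans_le ?_
    change limNorm _ ≤ ‖c‖ * limNorm y
    refine le_mul_of_forall_lt₀ fun r hr s hs => ?_
    have hr0 := (norm_nonneg c).trans hr.le
    refine limNorm_le (mul_nonneg hr0 ((limNorm_nonneg y).trans hs.le)) ?_
    filter_upwards [eventually_of_limNorm_lt hs] with t ht
    refine (norm_tmulRight_le B c (y t)).trans ?_
    rw [mul_comm]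
    exact mul_le_mul hr.le ht (norm_nonneg _) hr0

lemma tmulInf_toInf (B : CXAlgebra X) {C : Type} [NonUnitalCStarAlgebra C] (c : C)
    (y : Set.Ici (1 : ℝ) →ᵇ B) : tmulInf B c (B.toInf y) =
      (B.tensor C).toInf ((tmulRight B c).compLeftContinuousBounded _ y) :=
  (asympSeminorm B).liftCLM_toCompl _ _ _ y

lemma IsPullbackModel.isSuspension (hJ : IsPullbackModel J) {ψ' : AsymptoticHom D' E'}
    (h : IsExtension J K ψ ψ') {σ : AsymptoticHom D.susp E.susp}
    {σ' : AsymptoticHom D'.susp E'.susp} (hσ : IsExtension (J.tensor _) (K.tensor _) σ σ')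
    (hs : IsSuspension ψ σ) : IsSuspension ψ' σ' := by
  rw [isExtension_iff] at h hσ
  intro x g
  refine (toInf_eq_iff _ ((tmulRight E' g).compLeftContinuousBounded _ (ψ' x))).1 ?_
  rw [← tmulInf_toInf, ← AsymptoticHom.hom_apply, ← AsymptoticHom.hom_apply]
  refine hJ.ind (fun x => σ'.hom.hom (tmul x g) = tmulInf E' g (ψ'.hom.hom x))
    (isClosed_eq ((continuous_hom _).comp (continuous_tmul g))
      ((tmulInf E' g).continuous.comp (continuous_hom _))) ?_ ?_ ?_ x
  · change σ'.hom.hom (MaxTensor.tmul ∅ 0 g) = _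
    rw [MaxTensor.zero_tmul, map_zero ψ'.hom.hom, map_zero (tmulInf E' g)]
    exact map_zero σ'.hom.hom
  · intro x y hx hy
    change σ'.hom.hom (tmul (x + y) g) = tmulInf E' g (ψ'.hom.hom (x + y))
    rw [show tmul (x + y) g = tmul x g + tmul y g from MaxTensor.add_tmul _ _ _ _, map_add,
      map_add, map_add, hx, hy]
  · intro f d
    change σ'.hom.hom (tmul (f • J.hom d) g) = tmulInf E' g (ψ'.hom.hom (f • J.hom d))
    rw [← action_tmul, ← HomOver.tensor_tmul, Hom.map_action', Hom.map_action', hσ, h,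
      ← toInf_action, ← toInf_action, tmulInf_toInf]
    have h1 : E.susp.toInf (σ (tmul d g)) =
        E.susp.toInf ((tmulRight E g).compLeftContinuousBounded _ (ψ d)) :=
      (toInf_eq_iff _ _).2 (hs d g)
    rw [toInf_action, post_congr (K.tensor _).hom h1, ← toInf_action]
    congr 1
    ext t
    change f • (K.tensor _).hom (tmul (ψ d t) g) = tmul (f • K.hom (ψ d t)) g
    rw [HomOver.tensor_tmul, action_tmul]

end Extension

/-- `θ` is a pullback of `ψ`: up to asymptotic equivalence it is `id ⊗ ψ`, under the canonical
identification of `C(Y) ⊗_X Sⁿ(A ⊗ 𝓚)` with `Sⁿ(p^* A ⊗ 𝓚)`, and likewise for `B`. -/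
def IsPullback (p : C(Y, X)) {A B : CXAlgebra X} {n : ℕ} (ψ : ECycle A B n)
    (θ : ECycle (A.pullback p) (B.pullback p) n) : Prop :=
  IsExtension (cycleUnit p A n) (cycleUnit p B n) ψ θ

lemma exists_isPullback (p : C(Y, X)) {A B : CXAlgebra X} {n : ℕ} (ψ : ECycle A B n) :
    ∃ θ : ECycle (A.pullback p) (B.pullback p) n, IsPullback p ψ θ :=
  (isPullbackModel_cycleUnit p A n).exists_extension _ ψ

/-- A choice of the pullback of an asymptotic morphism. -/
def ECycle.pullback (p : C(Y, X)) {A B : CXAlgebra X} {n : ℕ} (ψ : ECycle A B n) :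
    ECycle (A.pullback p) (B.pullback p) n := (exists_isPullback p ψ).choose

lemma ECycle.isPullback (p : C(Y, X)) {A B : CXAlgebra X} {n : ℕ} (ψ : ECycle A B n) :
    IsPullback p ψ (ECycle.pullback p ψ) := (exists_isPullback p ψ).choose_spec

lemma RE.mk_eq_of_isPullback {p : C(Y, X)} {A B : CXAlgebra X} {n : ℕ} {ψ : ECycle A B n}
    {θ θ' : ECycle (A.pullback p) (B.pullback p) n} (h : IsPullback p ψ θ)
    (h' : IsPullback p ψ θ') : RE.mk n θ = RE.mk n θ' :=
  Quot.sound (.homotopy n θ θ' ((isPullbackModel_cycleUnit p A n).homotopic h h'))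

/-- The pullback transformation `p^* : RE(X; A, B) → RE(Y; p^* A, p^* B)`, which sends the class
of `ψ` to the class of `id ⊗ ψ`. -/
def RE.pullback (p : C(Y, X)) {A B : CXAlgebra X} :
    RE A B → RE (A.pullback p) (B.pullback p) :=
  Quot.lift (fun c => RE.mk c.1 (ECycle.pullback p c.2)) <| by
    rintro _ _ (⟨n, ψ₀, ψ₁, Ψ, h⟩ | ⟨n, ψ, σ, h⟩)
    · obtain ⟨Θ, hΘ⟩ := (isPullbackModel_cycleUnit p A n).exists_extension
        (cycleUnit p B n).interval Ψ
      have h0 : IsPullback p ψ₀ (Θ.evalAt 0) := hΘ.evalAt 0 fun a t => (h a t).1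
      have h1 : IsPullback p ψ₁ (Θ.evalAt 1) := hΘ.evalAt 1 fun a t => (h a t).2
      change RE.mk n (ECycle.pullback p ψ₀) = RE.mk n (ECycle.pullback p ψ₁)
      rw [RE.mk_eq_of_isPullback (ECycle.isPullback p ψ₀) h0,
        RE.mk_eq_of_isPullback (ECycle.isPullback p ψ₁) h1]
      exact Quot.sound (.homotopy n _ _ ⟨Θ, fun a t => ⟨rfl, rfl⟩⟩)
    · exact Quot.sound (.suspension n _ _ ((isPullbackModel_cycleUnit p A n).isSuspension
        (ECycle.isPullback p ψ) (ECycle.isPullback p σ) h))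

/-- The pullback transformation can be computed with any pullback of a representative. -/
lemma RE.pullback_mk {p : C(Y, X)} {A B : CXAlgebra X} {n : ℕ} {ψ : ECycle A B n}
    {θ : ECycle (A.pullback p) (B.pullback p) n} (h : IsPullback p ψ θ) :
    RE.pullback p (RE.mk n ψ) = RE.mk n θ :=
  RE.mk_eq_of_isPullback (ECycle.isPullback p ψ) h

/-- The ⋆-homomorphism `p^* : C(X) → C(Y)`. -/
def compBase (p : C(Y, X)) : HomOver p (base X) (base Y) where
  hom :=
    { toFun := fun f => (show C(X, ℂ) from f).comp p
      map_smul' := fun _ _ => rfl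
      map_zero' := rfl
      map_add' := fun _ _ => rfl
      map_mul' := fun _ _ => rfl
      map_star' := fun _ => rfl }
  map_action _ _ := rfl

/-- The morphism `C(Y) → p^* C(X)` is an isomorphism. -/
lemma pullbackBase_bijective (p : C(Y, X)) : Function.Bijective (pullbackBase p).hom := by
  constructor
  · refine Function.LeftInverse.injective (g := unitLift (compBase p)) fun g => ?_
    refine (unitLift_mk (compBase p) (show C(Y, ℂ) from g) (baseOne X)).trans ?_
    exact mul_one (show C(Y, ℂ) from g)
  · refine Function.RightInverse.surjective (g := unitLift (compBase p)) fun x => ?_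
    induction x using pullback_ind with
    | hc => exact isClosed_eq ((continuous_hom _).comp (continuous_hom _)) continuous_id
    | h0 => rw [map_zero, map_zero]
    | hadd x y hx hy => rw [map_add, map_add, hx, hy]
    | ht g f =>
      rw [unitLift_mk]
      have h := pullbackMk_balanced p (show C(X, ℂ) from f) g (baseOne X)
      rw [mul_comm] at h
      refine Eq.trans h ?_
      congr 1
      exact mul_one (show C(X, ℂ) from f)

/-- The pullback transformation `p^* : RE(X; C(X), A) → RE(Y; C(Y), p^* A)`, under the canonical
isomorphism of `C(Y)` with `p^* C(X)`. -/
def pullbackTransformation (p : C(Y, X)) (A : CXAlgebra X) :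
    RE (base X) A → RE (base Y) (A.pullback p) :=
  fun x => RE.precomp (pullbackBase p) (RE.pullback p x)

end CXAlgebra

end

/-! Both fundamental classes come from genuine `C(X)`- and `C(Y)`-linear ⋆-homomorphisms, so the
theorem reduces to an identity between such morphisms: under `C(Y) ≅ p^* C(X)`, `g ↦ g ⊗ 1`, the
morphism `id ⊗ Φ_A` becomes `Φ_{p^* A}`. On a function `g` this reads `g ↦ g ⊗ 1 ↦ g ⊗ Φ_A(1) = g ⊗
1_A = g • (1 ⊗ 1_A)`, and `1 ⊗ 1_A` is the unit of `p^* A`. This is `pullbackMap_structural`;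
everything else transports the identity to representable E-theory.

The transport has two halves. `RE.pullback_ofHom` computes `p^*` on the class of a morphism `φ`. The
transformation is defined through a chosen extension of each asymptotic morphism, and the choice is
immaterial by `RE.pullback_mk`: the elements `g • J d`, with `J` the canonical map `Sⁿ(A ⊗ 𝓚) →
Sⁿ(p^* A ⊗ 𝓚)`, span a dense subspace. Two extensions therefore induce the same ⋆-homomorphism into
the asymptotic algebra, and asymptotically equivalent families are homotopic. Hence it is enough to
exhibit one convenient extension, and the constant family of `(id ⊗ φ) ⊗ id_𝓚` is one
(`isPullback_const`), because `1 ⊗ φ(a)` is the image of `1 ⊗ a` under `id ⊗ φ`.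

`RE.precomp_ofHom` is the other half: precomposition of classes of morphisms is composition of
morphisms, because stabilization is functorial. All representatives stay at suspension level `0` and
are constant in `t`, so no limit has to be estimated; the analytic content sits in the uniqueness of
extensions, and what remains is checked on elementary tensors. -/

namespace CXAlgebra

section

variable {X Y : Type u} [TopologicalSpace X] [CompactSpace X] [TopologicalSpace Y]
  [CompactSpace Y]

/-! ### Functoriality of `p^*` for morphisms, and homomorphisms on tensor products -/

/-- The morphism `id ⊗ φ : p^* A → p^* B` induced by a morphism `φ : A → B`. -/
noncomputable def pullbackMap (p : C(Y, X)) {A B : CXAlgebra X} (φ : Hom A B) :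
    Hom (A.pullback p) (B.pullback p) :=
  -- `C(Y)` does not act on `A`, so the datum to extend is a map linear over `p`, namely `a ↦ 1 ⊗
  -- φ(a)`; the universal property of `p^* A` turns it into `g ⊗ a ↦ g • (1 ⊗ φ(a))`.
  let ψ : HomOver p A (B.pullback p) :=
    { hom := (pullbackUnit p B).hom.comp φ.hom
      map_action := fun f a => by
        change (pullbackUnit p B).hom (φ.hom (f • a)) =
          f.comp p • (pullbackUnit p B).hom (φ.hom a)
        -- The second rewrite is where balancing enters: in `p^* B`, a function `f` on `X` acting on
        -- the right factor equals `f ∘ p` acting on the left factor.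
        rw [φ.map_action', (pullbackUnit p B).map_action] }
  -- The explicit lift is used rather than the existence statement of `IsPullbackModel`, so that its
  -- value on every `g ⊗ a` is available afterwards.
  { hom := unitLift ψ
    map_action := fun f x => by
      change unitLift ψ (f • x) = f • unitLift ψ x
      -- The lift is a priori only a ⋆-homomorphism. Its `C(Y)`-linearity is a closed, additive
      -- condition in `x`, since ⋆-homomorphisms of C⋆-algebras and the action are continuous; on `g
      -- ⊗ a` it is associativity of the action.
      induction x using pullback_ind with
      | hc =>
        exact isClosed_eq ((continuous_hom _).comp (continuous_action f))
          ((continuous_action _).comp (continuous_hom _))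
      | h0 => rw [smul_zero, map_zero, smul_zero]
      | hadd x y hx hy => rw [smul_add, map_add, map_add, smul_add, hx, hy]
      | ht g a => rw [action_pullbackMk, unitLift_mk, unitLift_mk, mul_smul] }

/-- The lift produces `g • (1 ⊗ φ(a))`, and the action through the left factor absorbs `g`. The
formula serves twice: with `g = 1` to recognise `id ⊗ φ` as an extension of `φ`, and with `a` the
constant function `1` to compute the pulled back structural morphism. -/
lemma pullbackMap_mk (p : C(Y, X)) {A B : CXAlgebra X} (φ : Hom A B) (g : C(Y, ℂ)) (a : A) :
    (pullbackMap p φ).hom (pullbackMk p g a) = pullbackMk p g (φ.hom a) :=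
  (unitLift_mk _ g a).trans (smul_pullbackUnit p g (φ.hom a))

/-- Two ⋆-homomorphisms out of `A ⊗ C` that agree on elementary tensors are equal. -/
lemma tensor_hom_ext {A B : CXAlgebra X} {C : Type} [NonUnitalCStarAlgebra C]
    {φ ψ : A.tensor C →⋆ₙₐ[ℂ] B} (h : ∀ a c, φ (tmul a c) = ψ (tmul a c)) (x : A.tensor C) :
    φ x = ψ x := by
  induction x using tensor_ind with
  -- No boundedness has to be assumed: ⋆-homomorphisms between C⋆-algebras are contractive.
  | hc => exact isClosed_eq (continuous_hom _) (continuous_hom _)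
  | h0 => rw [map_zero, map_zero]
  | hadd x y hx hy => rw [map_add, map_add, hx, hy]
  | ht a c => exact h a c

/-! ### Classes of morphisms under pullback and precomposition -/

/-- The constant family of `p^* φ ⊗ id` is a pullback of the constant family of `φ ⊗ id`. -/
lemma isPullback_const (p : C(Y, X)) {A B : CXAlgebra X} (φ : Hom A B) :
    IsPullback p (n := 0) (AsymptoticHom.const φ.stab)
      (AsymptoticHom.const (pullbackMap p φ).stab) := by
  -- By `C(Y)`-linearity in the asymptotic algebra, the defining condition on all `g • J d` reduces
  -- to the case `g = 1`.
  refine isExtension_iff.2 fun d => ?_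
  -- Both families are constant in `t` and will agree exactly, so the equality is proved before
  -- passing to the quotient by functions vanishing at infinity.
  refine congrArg ((B.pullback p).stab.iterSusp 0).toInf (BoundedContinuousFunction.ext fun t => ?_)
  -- At `n = 0` there is no suspension, so `cycleUnit` is just the stabilization of `a ↦ 1 ⊗ a`.
  -- What remains is naturality of that map in `φ`, tensored with `𝓚`.
  change ((pullbackMap p φ).stab.hom) ((pullbackUnit p A).stab.hom d) =
    (pullbackUnit p B).stab.hom (φ.stab.hom d)
  -- The source is an algebra over `X` and the target one over `Y`. `tensor_hom_ext` compares
  -- algebras over a single space, so the density argument is carried out directly here.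
  induction d using tensor_ind with
  | hc =>
    exact isClosed_eq ((continuous_hom _).comp (continuous_hom _))
      ((continuous_hom _).comp (continuous_hom _))
  | h0 => simp only [map_zero]
  | hadd x y hx hy => rw [map_add, map_add, map_add, map_add, hx, hy]
  | ht a c =>
    -- Either way around the square, `a ⊗ c` ends at `(1 ⊗ φ(a)) ⊗ c`.
    simp only [HomOver.stab, HomOver.tensor_tmul, pullbackUnit_apply, pullbackMap_mk]

/-- The pullback transformation sends the class of `φ` to the class of `p^* φ`. -/
lemma RE.pullback_ofHom (p : C(Y, X)) {A B : CXAlgebra X} (φ : Hom A B) :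
    RE.pullback p (RE.ofHom φ) = RE.ofHom (pullbackMap p φ) :=
  -- `RE.ofHom` is by definition the class of a constant family at level `0`, so the extension
  -- chosen in the definition of `RE.pullback` may be traded for the constant one.
  RE.pullback_mk (isPullback_const p φ)

/-- If `φ' ∘ φ = ψ`, then precomposition with `φ` sends the class of `φ'` to that of `ψ`. -/
lemma RE.precomp_ofHom {A A' B : CXAlgebra X} {φ : Hom A' A} {φ' : Hom A B} {ψ : Hom A' B}
    (h : ∀ a, φ'.hom (φ.hom a) = ψ.hom a) :
    RE.precomp φ (RE.ofHom φ') = RE.ofHom ψ := by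
  -- The representatives turn out to have the same values, so the straight-line homotopy behind
  -- `homotopic_of_equiv` is constant. Passing through the homotopy relation means that only values
  -- need comparing, not the asymptotic morphisms as structures.
  refine Quot.sound (.homotopy 0 _ _ (homotopic_of_equiv fun x => ?_))
  refine congrArg B.stab.toInf (BoundedContinuousFunction.ext fun t => ?_)
  change φ'.stab.hom (φ.stab.hom x) = ψ.stab.hom x
  -- This is functoriality of `- ⊗ 𝓚`. The composite is named so that the left side is seen as one
  -- ⋆-homomorphism out of `A' ⊗ 𝓚`; on `a ⊗ c` the hypothesis `h` then acts in the first factor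
  -- only.
  refine tensor_hom_ext (φ := φ'.stab.hom.comp φ.stab.hom) (fun a c => ?_) x
  change φ'.stab.hom (φ.stab.hom (tmul a c)) = ψ.stab.hom (tmul a c)
  simp only [HomOver.stab, HomOver.tensor_tmul, h]

/-! ### Structural morphisms under pullback, and the conclusion -/

/-- Under `C(Y) ≅ p^* C(X)`, the pullback of the structural morphism of `A` is the structural
morphism of `p^* A`. -/
lemma pullbackMap_structural (p : C(Y, X)) (A : CXAlgebra X) (hA : A.IsUnital) (g : base Y) :
    (pullbackMap p (A.structural hA)).hom ((pullbackBase p).hom g) =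
      ((A.pullback p).structural (hA.pullback p)).hom g := by
  -- The unit attached to `hA.pullback p` is extracted from an existence statement, so it is not `1
  -- ⊗ 1_A` by definition. A left identity must coincide with it, and being a left identity can be
  -- tested on elementary tensors.
  have h1 : pullbackMk p 1 hA.unit = (hA.pullback p).unit := by
    refine (hA.pullback p).eq_unit fun x => ?_
    induction x using pullback_ind with
    | hc => exact isClosed_eq (continuous_const.mul continuous_id) continuous_id
    | h0 => exact mul_zero _
    | hadd x y hx hy => rw [mul_add, hx, hy]
    | ht g a => rw [pullbackMk_mul, one_mul, hA.unit_mul]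
  -- The isomorphism `C(Y) → p^* C(X)` sends `g` to `g ⊗ 1` by definition, so the left side is
  -- already an elementary tensor and becomes `g ⊗ Φ_A(1)`.
  refine (pullbackMap_mk p _ _ _).trans ?_
  change pullbackMk p (show C(Y, ℂ) from g) ((1 : C(X, ℂ)) • hA.unit) =
    (show C(Y, ℂ) from g) • (hA.pullback p).unit
  -- `Φ_A(1) = 1 • 1_A = 1_A` because the action of `C(X)` is unital; on the other side `g • (1 ⊗
  -- 1_A) = (g · 1) ⊗ 1_A`.
  rw [← h1, one_smul, action_pullbackMk, mul_one]

end

end CXAlgebra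

/-- The unitality of `p^* A` enters through the argument `hA.pullback p`, without which the right
side could not be formed. The identification of `p^* C(X)` with `C(Y)` is part of
`pullbackTransformation`, as precomposition with `pullbackBase p`. -/
theorem proposition5p7 {X Y : Type u} [TopologicalSpace X] [CompactSpace X] [T2Space X]
    [TopologicalSpace Y] [CompactSpace Y] [T2Space Y] (p : C(Y, X)) (A : CXAlgebra X)
    (hA : A.IsUnital) :
    CXAlgebra.pullbackTransformation p A (CXAlgebra.fundamentalClass A hA) =
      CXAlgebra.fundamentalClass (A.pullback p) (hA.pullback p) := by
  -- Unfolding the definitions, the left side is the precomposition by `pullbackBase p` of the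
  -- pullback of the class of `Φ_A`; the inner pullback is replaced by the class of `id ⊗ Φ_A`.
  refine (congrArg (CXAlgebra.RE.precomp (CXAlgebra.pullbackBase p))
    (CXAlgebra.RE.pullback_ofHom p (A.structural hA))).trans ?_
  -- What is left is the commuting triangle `C(Y) → p^* C(X) → p^* A`, whose composite is `Φ_{p^*
  -- A}`.
  exact CXAlgebra.RE.precomp_ofHom (CXAlgebra.pullbackMap_structural p A hA)
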